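/- Let $\Lambda$ be the hexagonal-lattice torus of side $L$: its $2L^2$ sites are the faces of the triangular lattice in a rhombus of side $L$ along two lattice axes, with periodic boundary conditions, and two sites are nearest neighbours when the corresponding faces share an edge. For $\sigma\in\mathcal X=\{-1,+1\}^\Lambda$ let $$H(\sigma)=-\frac J2\sum_{\{i,j\}\ \text{nearest neighbours}}\sigma(i)\sigma(j)-\frac h2\sum_{i\in\Lambda}\sigma(i),$$ each pair being counted once. Assume $0<h<1$, $J\ge 2h$, $\frac{J}{2h}-\frac12\notin\mathbb Z$ and $|\Lambda|\ge(4J/h)^2$. For $\beta>0$ let $(X_t)_{t\in\mathbb N}$ be the Metropolis chain on $\mathcal X$: for $\eta\ne\sigma$, $P(\sigma,\eta)=\frac1{|\Lambda|}e^{-\beta\max(H(\eta)-H(\sigma),0)}$ if $\eta$ is obtained from $\sigma$ by flipping one spin and $P(\sigma,\eta)=0$ otherwise, and $P(\sigma,\sigma)=1-\sum_{\eta\neq\sigma}P(\sigma,\eta)$. Write $\mathbb P_{\underline{-1}}$ and $\mathbb E_{\underline{-1}}$ for probability and expectation for the chain started from the configuration $\underline{-1}$ with all spins $-1$, and let $\tau_{\underline{+1}}=\inf\{t>0: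 X_t=\underline{+1}\}$ be the first hitting time of the configuration $\underline{+1}$ with all spins $+1$. Let $$T_\beta=\inf\{n\ge1:\ \mathbb P_{\underline{-1}}(\tau_{\underline{+1}}\le n)\ge 1-e^{-1}\}.$$ Then, with $L$, $J$, $h$ fixed, $$\lim_{\beta\to\infty}\mathbb P_{\underline{-1}}(\tau_{\underline{+1}}>tT_\beta)=e^{-t}\quad\text{for every } t\ge0,\qquad\text{and}\qquad \lim_{\beta\to\infty}\frac{\mathbb E_{\underline{-1}}[\tau_{\underline{+1}}]}{T_\beta}=1 .$$ -/

import Mathlib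

open MeasureTheory ProbabilityTheory Filter Topology
open scoped NNReal ENNReal

namespace HexIsing

/-- The sites of the `L × L` torus. The cell `(a, b)` of the triangular lattice (coordinates along
two of its axes, taken modulo `L`) is split into an upper-pointing face `Sum.inl (a, b)`, with
vertices `(a, b), (a+1, b), (a, b+1)`, and a lower-pointing face `Sum.inr (a, b)`, with vertices
`(a+1, b), (a, b+1), (a+1, b+1)`. The sites of the hexagonal lattice are the centres of the
triangular faces. -/
abbrev Site (L : ℕ) : Type := (ZMod L × ZMod L) ⊕ (ZMod L × ZMod L)

/-- The upper-pointing face of the cell `u` has a common edge with the lower-pointing face of the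
cell `d`. -/
def ShareEdge {L : ℕ} (u d : ZMod L × ZMod L) : Prop :=
  d = u ∨ d = (u.1 - 1, u.2) ∨ d = (u.1, u.2 - 1)

/-- The hexagonal lattice with periodic boundary conditions: sites at lattice distance one are
adjacent, that is, the corresponding triangular faces have a common edge. -/
def hexTorus (L : ℕ) : SimpleGraph (Site L) where
  Adj
    | .inl u, .inr d => ShareEdge u d
    | .inr d, .inl u => ShareEdge u d
    | _, _ => False
  symm := ⟨by rintro (u | u) (d | d) h <;> exact h⟩
  loopless := ⟨by rintro (u | u) h <;> exact h⟩

/-- Spin configurations `Λ → {-1, +1}`. -/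
abbrev Config (L : ℕ) : Type := Site L → ℤˣ

/-- The spin `σ(i)` as a real number. -/
def spin {L : ℕ} (σ : Config L) (i : Site L) : ℝ := ((σ i : ℤ) : ℝ)

open scoped Classical in
/-- The Hamiltonian; the interaction runs over the pairs of nearest neighbours, each pair counted
once. -/
noncomputable def energy {L : ℕ} [NeZero L] (J h : ℝ) (σ : Config L) : ℝ :=
  -(J / 2) * ∑ e ∈ (hexTorus L).edgeFinset, (e.map (spin σ)).mul - (h / 2) * ∑ i, spin σ i

/-- The configuration `σ^(x)`, obtained from `σ` by flipping the spin at `x`. -/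
def flip {L : ℕ} (σ : Config L) (x : Site L) : Config L := Function.update σ x (-σ x)

open scoped Classical in
/-- The connectivity matrix `q(σ, η)`, for `σ ≠ η`. -/
noncomputable def connectivity {L : ℕ} [NeZero L] (σ η : Config L) : ℝ :=
  if ∃ x, flip σ x = η then 1 / (Fintype.card (Site L) : ℝ) else 0

/-- The Metropolis probability `q(σ, η) exp (-β [H(η) - H(σ)]₊)` of a jump from `σ` to `η ≠ σ`. -/
noncomputable def jumpProb {L : ℕ} [NeZero L] (J h : ℝ) (β : ℝ≥0) (σ η : Config L) : ℝ :=
  connectivity σ η * Real.exp (-(β : ℝ) * max (energy J h η - energy J h σ) 0)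

/-- The transition matrix of the Metropolis dynamics. -/
noncomputable def transProb {L : ℕ} [NeZero L] (J h : ℝ) (β : ℝ≥0) (σ η : Config L) : ℝ :=
  if η = σ then 1 - ∑ ζ ∈ Finset.univ.erase σ, jumpProb J h β σ ζ else jumpProb J h β σ η

section Stochastic

variable {L : ℕ} [NeZero L] (J h : ℝ) (β : ℝ≥0) (σ : Config L)

lemma connectivity_nonneg (η : Config L) : 0 ≤ connectivity σ η := by
  unfold connectivity
  split_ifs <;> positivity

lemma jumpProb_nonneg (η : Config L) : 0 ≤ jumpProb J h β σ η :=
  mul_nonneg (connectivity_nonneg σ η) (Real.exp_pos _).le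

lemma sum_jumpProb_le_one : ∑ ζ ∈ Finset.univ.erase σ, jumpProb J h β σ ζ ≤ 1 := by
  classical
  calc ∑ ζ ∈ Finset.univ.erase σ, jumpProb J h β σ ζ
      ≤ ∑ ζ, jumpProb J h β σ ζ :=
        Finset.sum_le_sum_of_subset_of_nonneg (Finset.erase_subset _ _)
          fun ζ _ _ => jumpProb_nonneg J h β σ ζ
    _ ≤ ∑ ζ, connectivity σ ζ := by
        refine Finset.sum_le_sum fun ζ _ => ?_
        refine mul_le_of_le_one_right (connectivity_nonneg σ ζ) (Real.exp_le_one_iff.2 ?_)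
        have : 0 ≤ (β : ℝ) * max (energy J h ζ - energy J h σ) 0 :=
          mul_nonneg β.2 (le_max_right _ _)
        linarith
    _ = ((Finset.univ.image (flip σ)).card : ℝ) * (1 / (Fintype.card (Site L) : ℝ)) := by
        unfold connectivity
        rw [← Finset.sum_filter, Finset.sum_const, nsmul_eq_mul]
        congr 3
        ext ζ
        simp
    _ ≤ (Fintype.card (Site L) : ℝ) * (1 / (Fintype.card (Site L) : ℝ)) := by
        refine mul_le_mul_of_nonneg_right ?_ (by positivity)
        exact_mod_cast Finset.card_image_le
    _ ≤ 1 := by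
        rw [mul_one_div]
        exact div_self_le_one _

lemma transProb_nonneg (η : Config L) : 0 ≤ transProb J h β σ η := by
  unfold transProb
  split_ifs
  · linarith [sum_jumpProb_le_one J h β σ]
  · exact jumpProb_nonneg J h β σ η

lemma sum_transProb : ∑ η, transProb J h β σ η = 1 := by
  rw [← Finset.add_sum_erase _ _ (Finset.mem_univ σ)]
  have : ∑ η ∈ Finset.univ.erase σ, transProb J h β σ η
      = ∑ η ∈ Finset.univ.erase σ, jumpProb J h β σ η :=
    Finset.sum_congr rfl fun η hη => if_neg (Finset.ne_of_mem_erase hη)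
  rw [this, transProb, if_pos rfl]
  ring

/-- The law of one step of the dynamics from `σ`. -/
noncomputable def stepPMF : PMF (Config L) :=
  PMF.ofFintype (fun η => ENNReal.ofReal (transProb J h β σ η)) (by
    rw [← ENNReal.ofReal_sum_of_nonneg fun η _ => transProb_nonneg J h β σ η, sum_transProb,
      ENNReal.ofReal_one])

end Stochastic

instance : DiscreteMeasurableSpace ℤˣ :=
  ⟨fun s => ⟨Units.val '' s, trivial, Set.preimage_image_eq s Units.val_injective⟩⟩

/-- The transition kernel of the Metropolis dynamics. -/
noncomputable def stepKernel {L : ℕ} [NeZero L] (J h : ℝ) (β : ℝ≥0) :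
    Kernel (Config L) (Config L) :=
  Kernel.ofFunOfCountable fun σ => (stepPMF J h β σ).toMeasure

instance {L : ℕ} [NeZero L] (J h : ℝ) (β : ℝ≥0) :
    IsMarkovKernel (stepKernel (L := L) J h β) :=
  ⟨fun σ => PMF.toMeasure.isProbabilityMeasure (stepPMF J h β σ)⟩

/-- The law `ℙ_σ` on trajectories `X₀, X₁, X₂, …` of the Metropolis chain started from `σ`. -/
noncomputable def chainLaw {L : ℕ} [NeZero L] (J h : ℝ) (β : ℝ≥0) (σ : Config L) :
    Measure (ℕ → Config L) :=
  Kernel.trajMeasure (X := fun _ => Config L) (Measure.dirac σ) fun n =>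
    (stepKernel J h β).comap (fun x => x ⟨n, Finset.mem_Iic.2 le_rfl⟩) (measurable_pi_apply _)

/-- The first hitting time `inf {t > 0 | X_t ∈ A}` of a trajectory, `∞` if `A` is never hit. -/
noncomputable def hitTime {L : ℕ} (A : Set (Config L)) (X : ℕ → Config L) : ℕ∞ :=
  hittingAfter (fun t (Y : ℕ → Config L) => Y t) A 1 X

/-- The configuration with all spins `-1`. -/
def allMinus (L : ℕ) : Config L := fun _ => -1

/-- The configuration with all spins `+1`. -/
def allPlus (L : ℕ) : Config L := fun _ => 1

/-- `T_β = inf {n ≥ 1 | ℙ_{-1}(τ_{+1} ≤ n) ≥ 1 - e⁻¹}`. -/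
noncomputable def quantileTime (L : ℕ) [NeZero L] (J h : ℝ) (β : ℝ≥0) : ℕ :=
  sInf {n : ℕ | 1 ≤ n ∧
    1 - Real.exp (-1) ≤ (chainLaw J h β (allMinus L)).real {X | hitTime {allPlus L} X ≤ n}}

/-- The mean hitting time `𝔼_{-1}[τ_{+1}]`, possibly infinite. -/
noncomputable def meanHitTime (L : ℕ) [NeZero L] (J h : ℝ) (β : ℝ≥0) : ℝ≥0∞ :=
  ∫⁻ X, (hitTime {allPlus L} X : ℝ≥0∞) ∂(chainLaw J h β (allMinus L))

end HexIsing

namespace HexIsing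

/-! The hitting time is asymptotically exponential because the chain forgets its past long before it
can leave $\underline{-1}$. Two energy estimates suffice; the height of the barrier between the two
constant configurations is never needed. From every configuration, flips rising at most $2J$ lead to
one of the constants (`exists_reach_const`), whereas every flip out of $\underline{-1}$ costs
$3J-h$, which exceeds $2J$ because $h<J$.

The geometric input is `improves_of_ne`. In a configuration that cannot be improved, take a straight
side of $n$ edges of the plus phase between two convex corners. Filling the row outside it ($2n-1$
faces) changes the energy by $J-(2n-1)h$, emptying the row inside it ($2n+1$ faces) by $-J+(2n+1)h$.
Neither helps only if $(2n-1)h<J<(2n+1)h$, where equality is excluded by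
$\frac{J}{2h}-\frac12\notin\mathbb Z$. So the two sides meeting at a corner have the same length
$n$. Filling rows on both changes the energy by $2J-4nh$, emptying rows on both by $4nh-2J$, and one
of the two is an improvement; in the tie $J=2nh$ the magnetization decides, which is why `Improves`
mentions it. Hence there are no corners, a side would have to wrap around the torus, and filling its
row lowers the energy.

For the dynamics, paths of height $2J$ give a Poincaré inequality for the reversible chain killed on
the two constants, so these are hit within a time $R\approx e^{\beta(2J+\kappa)}$ from anywhere
(`exists_survival_le`). Leaving $\underline{-1}$ within $2R$ is unlikely when $\kappa$ is small.
Restarting at $\underline{-1}$ then gives $s(n+k)\approx s(n)s(k)$ for the tail $s(n)=\mathbb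
P(\tau>n)$ (`abs_survival_add_sub_le`), and a monotone, almost multiplicative function with $s(T)\to
e^{-1}$ is exponential on the scale $T$ (`tendsto_floor_exp`). The mean is the sum of the tail, and
dominated convergence yields its limit (`tendsto_tsum_div`). -/

open scoped Classical in
/-- The sum over directed edges of a function of the underlying edge is twice the sum over edges. -/
lemma sum_sum_adj_eq_two_mul {V : Type*} [Fintype V] (G : SimpleGraph V) (f : Sym2 V → ℝ) :
    ∑ x, ∑ y, (if G.Adj x y then f s(x, y) else 0) = 2 * ∑ e ∈ G.edgeFinset, f e := by
  have h1 : ∑ x, ∑ y, (if G.Adj x y then f s(x, y) else 0) = ∑ d : G.Dart, f d.edge := by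
    rw [← Fintype.sum_prod_type', ← Finset.sum_filter]
    symm
    refine Finset.sum_bij (fun d _ => d.toProd) ?_ ?_ ?_ ?_
    · intro d _
      simp
    · intro d _ d' _ h
      exact SimpleGraph.Dart.ext _ _ h
    · rintro ⟨x, y⟩ h
      exact ⟨⟨(x, y), by simpa using h⟩, Finset.mem_univ _, rfl⟩
    · intro d _
      rfl
  rw [h1, ← Finset.sum_fiberwise_of_maps_to (t := G.edgeFinset) (g := fun d : G.Dart => d.edge)
    (fun d _ => by simp), Finset.mul_sum]
  refine Finset.sum_congr rfl fun e he => ?_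
  rw [Finset.sum_congr rfl (g := fun _ => f e)
    (fun d hd => by rw [(Finset.mem_filter.1 hd).2]), Finset.sum_const,
    G.dart_edge_fiber_card e (by simpa using he)]
  simp

open scoped Classical in
/-- The sum of the spins at the nearest neighbours of a site. -/
noncomputable def nbrSum {L : ℕ} [NeZero L] (σ : Config L) (x : Site L) : ℝ :=
  ∑ y, if (hexTorus L).Adj x y then spin σ y else 0

/-- The total magnetization. -/
noncomputable def magnetization {L : ℕ} [NeZero L] (σ : Config L) : ℝ := ∑ x, spin σ x

/-! ### Spin flips and energy differences -/

section Basic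

variable {L : ℕ}

lemma flip_comp (σ : Config L) (φ : hexTorus L ≃g hexTorus L) (x : Site L) :
    flip (σ ∘ φ) x = flip σ (φ x) ∘ φ := by
  funext y
  by_cases hy : y = x
  · subst hy; simp [flip]
  · simp [flip, hy]

lemma flip_apply_self (σ : Config L) (x : Site L) : flip σ x x = -σ x := by simp [flip]

lemma flip_apply_ne (σ : Config L) {x y : Site L} (hy : y ≠ x) : flip σ x y = σ y := by
  simp [flip, hy]

lemma flip_flip (σ : Config L) (x : Site L) : flip (flip σ x) x = σ := by
  funext y
  by_cases hy : y = x
  · subst hy; simp [flip]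
  · simp [flip, hy]

lemma flip_ne (σ : Config L) (x : Site L) : flip σ x ≠ σ := by
  intro h
  have := congrFun h x
  rw [flip_apply_self] at this
  rcases Int.units_eq_one_or (σ x) with hx | hx <;> rw [hx] at this <;> exact absurd this (by decide)

lemma spin_flip (σ : Config L) (x y : Site L) :
    spin (flip σ x) y = spin σ y - if y = x then 2 * spin σ x else 0 := by
  by_cases hy : y = x
  · subst hy
    simp [spin, flip_apply_self]
    ring
  · simp [spin, flip_apply_ne σ hy, hy]

lemma adj_inl_inr {u d : ZMod L × ZMod L} :
    (hexTorus L).Adj (.inl u) (.inr d) ↔ d = u ∨ d = (u.1 - 1, u.2) ∨ d = (u.1, u.2 - 1) := Iff.rfl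

lemma adj_inr_inl {u d : ZMod L × ZMod L} :
    (hexTorus L).Adj (.inr d) (.inl u) ↔ d = u ∨ d = (u.1 - 1, u.2) ∨ d = (u.1, u.2 - 1) := Iff.rfl

lemma not_adj_inl_inl {u d : ZMod L × ZMod L} : ¬ (hexTorus L).Adj (.inl u) (.inl d) := id

lemma not_adj_inr_inr {u d : ZMod L × ZMod L} : ¬ (hexTorus L).Adj (.inr u) (.inr d) := id

lemma spin_eq_one_or (σ : Config L) (x : Site L) : spin σ x = 1 ∨ spin σ x = -1 := by
  rcases Int.units_eq_one_or (σ x) with hx | hx <;> simp [spin, hx]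

lemma spin_mul_of_ne {σ : Config L} {x y : Site L} (h : σ y ≠ σ x) : spin σ x * spin σ y = -1 := by
  rcases Int.units_eq_one_or (σ x) with hx | hx <;> rcases Int.units_eq_one_or (σ y) with hy | hy <;>
    simp_all [spin]

lemma spin_mul_le_one (σ : Config L) (x y : Site L) : spin σ x * spin σ y ≤ 1 := by
  rcases spin_eq_one_or σ x with h | h <;> rcases spin_eq_one_or σ y with h' | h' <;>
    rw [h, h'] <;> norm_num

end Basic

section Energy

variable {L : ℕ} [NeZero L]

open scoped Classical in
lemma energy_eq (J h : ℝ) (σ : Config L) :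
    energy J h σ = -(J / 4) * ∑ x, ∑ y, (if (hexTorus L).Adj x y then spin σ x * spin σ y else 0)
      - (h / 2) * magnetization σ := by
  have := sum_sum_adj_eq_two_mul (hexTorus L) fun e => (e.map (spin σ)).mul
  simp only [Sym2.map_mk, Sym2.mul_mk] at this
  rw [this, energy, magnetization]
  ring

lemma energy_comp (J h : ℝ) (σ : Config L) (φ : hexTorus L ≃g hexTorus L) :
    energy J h (σ ∘ φ) = energy J h σ := by
  classical
  have h1 : ∀ x, spin (σ ∘ φ) x = spin σ (φ x) := fun x => rfl
  simp only [energy_eq, magnetization, h1]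
  congr 2
  · rw [← φ.toEquiv.sum_comp fun x => ∑ y, (if (hexTorus L).Adj x y then spin σ x * spin σ y else 0)]
    refine Finset.sum_congr rfl fun x _ => ?_
    rw [← φ.toEquiv.sum_comp fun y => if (hexTorus L).Adj (φ.toEquiv x) y then _ else _]
    refine Finset.sum_congr rfl fun y _ => ?_
    have : (hexTorus L).Adj (φ x) (φ y) ↔ (hexTorus L).Adj x y := φ.map_adj_iff
    simp [this]
  · exact φ.toEquiv.sum_comp (spin σ)

lemma magnetization_comp (σ : Config L) (φ : hexTorus L ≃g hexTorus L) :
    magnetization (σ ∘ φ) = magnetization σ :=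
  φ.toEquiv.sum_comp (spin σ)

lemma magnetization_flip (σ : Config L) (x : Site L) :
    magnetization (flip σ x) = magnetization σ - 2 * spin σ x := by
  simp [magnetization, spin_flip, Finset.sum_sub_distrib]

lemma energy_flip (J h : ℝ) (σ : Config L) (x : Site L) :
    energy J h (flip σ x) = energy J h σ + spin σ x * (J * nbrSum σ x + h) := by
  classical
  -- Each bond at `x` occurs in both orders and its product changes sign, whence the factor
  -- $4=2\cdot2$.
  have key : ∑ y, ∑ z, (if (hexTorus L).Adj y z then spin (flip σ x) y * spin (flip σ x) z else 0)
      = ∑ y, ∑ z, (if (hexTorus L).Adj y z then spin σ y * spin σ z else 0)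
        - 4 * spin σ x * nbrSum σ x := by
    have e1 : ∀ y z, (if (hexTorus L).Adj y z then spin (flip σ x) y * spin (flip σ x) z else 0)
        = (if (hexTorus L).Adj y z then spin σ y * spin σ z else 0)
          - (if y = x then 2 * spin σ x * (if (hexTorus L).Adj x z then spin σ z else 0) else 0)
          - (if z = x then 2 * spin σ x * (if (hexTorus L).Adj x y then spin σ y else 0) else 0) := by
      intro y z
      rw [spin_flip, spin_flip]
      by_cases hy : y = x
      · subst hy
        by_cases hz : z = y
        · subst hz; simp
        · simp [hz]; split_ifs <;> ring
      · by_cases hz : z = x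
        · subst hz
          simp [hy, (hexTorus L).adj_comm y z]; split_ifs <;> ring
        · simp [hy, hz]
    simp only [e1, Finset.sum_sub_distrib]
    have e2 : ∑ y, ∑ z, (if y = x then 2 * spin σ x * (if (hexTorus L).Adj x z then spin σ z else 0)
        else 0) = 2 * spin σ x * nbrSum σ x := by
      rw [Finset.sum_eq_single x (fun y _ hy => by simp [hy]) (by simp)]
      simp only [if_true, nbrSum, Finset.mul_sum]
    have e3 : ∑ y, ∑ z, (if z = x then 2 * spin σ x * (if (hexTorus L).Adj x y then spin σ y else 0)
        else 0) = 2 * spin σ x * nbrSum σ x := by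
      rw [Finset.sum_comm]
      exact e2
    rw [e2, e3]
    ring
  rw [energy_eq, energy_eq, key, magnetization_flip]
  ring

open scoped Classical in
lemma card_filter_adj (hL : 2 ≤ L) (x : Site L) :
    (Finset.univ.filter fun y => (hexTorus L).Adj x y).card = 3 := by
  have : Fact (1 < L) := ⟨hL⟩
  rw [Finset.card_eq_three]
  rcases x with ⟨a, b⟩ | ⟨a, b⟩
  · refine ⟨.inr (a, b), .inr (a - 1, b), .inr (a, b - 1), by simp [eq_sub_iff_add_eq], by simp [eq_sub_iff_add_eq],
      by simp, ?_⟩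
    ext (y | y)
    · simp [not_adj_inl_inl]
    · simp [adj_inl_inr]
  · refine ⟨.inl (a, b), .inl (a + 1, b), .inl (a, b + 1), by simp, by simp, by simp, ?_⟩
    ext (⟨c, d⟩ | y)
    · simp only [Finset.mem_filter, Finset.mem_univ, true_and, adj_inr_inl, Finset.mem_insert,
        Finset.mem_singleton, Sum.inl.injEq, Prod.mk.injEq, eq_sub_iff_add_eq]
      constructor <;> rintro (⟨h1, h2⟩ | ⟨h1, h2⟩ | ⟨h1, h2⟩) <;> simp [h1, h2]
    · simp [not_adj_inr_inr]

/-- There are three neighbours; those in `s` contribute $-1$ each and the others at most $1$. One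
disagreeing neighbour therefore bounds the bond cost of a flip by $J$, two by $-J$. -/
lemma spin_mul_nbrSum_le (hL : 2 ≤ L) (σ : Config L) (x : Site L) (s : Finset (Site L))
    (hs : ∀ y ∈ s, (hexTorus L).Adj x y ∧ σ y ≠ σ x) :
    spin σ x * nbrSum σ x ≤ 3 - 2 * s.card := by
  classical
  set N := Finset.univ.filter fun y => (hexTorus L).Adj x y with hN
  have hsN : s ⊆ N := fun y hy => by simp [hN, (hs y hy).1]
  have e : spin σ x * nbrSum σ x = ∑ y ∈ N, spin σ x * spin σ y := by
    rw [nbrSum, ← Finset.sum_filter, Finset.mul_sum]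
  have hc := Finset.card_sdiff_add_card_eq_card hsN
  rw [hN, card_filter_adj hL, ← hN] at hc
  have hc' : ((N \ s).card : ℝ) + s.card = 3 := by exact_mod_cast hc
  have h1 : ∑ y ∈ N \ s, spin σ x * spin σ y ≤ (N \ s).card := by
    simpa using Finset.sum_le_sum fun y (_ : y ∈ N \ s) => spin_mul_le_one σ x y
  have h2 : ∑ y ∈ s, spin σ x * spin σ y = -s.card := by
    rw [Finset.sum_congr rfl fun y hy => spin_mul_of_ne (hs y hy).2]; simp
  rw [e, ← Finset.sum_sdiff hsN, h2]
  linarith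

lemma energy_flip_le_one (hL : 2 ≤ L) {J : ℝ} (hJ : 0 ≤ J) (h : ℝ) {σ : Config L} {x y : Site L}
    (hy : (hexTorus L).Adj x y) (hσ : σ y ≠ σ x) :
    energy J h (flip σ x) ≤ energy J h σ + J + spin σ x * h := by
  have := spin_mul_nbrSum_le hL σ x {y} (by simp [hy, hσ])
  simp at this
  rw [energy_flip]
  nlinarith

lemma energy_flip_le_two (hL : 2 ≤ L) {J : ℝ} (hJ : 0 ≤ J) (h : ℝ) {σ : Config L} {x y z : Site L}
    (hyz : y ≠ z) (hy : (hexTorus L).Adj x y) (hσ : σ y ≠ σ x) (hz : (hexTorus L).Adj x z)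
    (hσ' : σ z ≠ σ x) :
    energy J h (flip σ x) ≤ energy J h σ - J + spin σ x * h := by
  have := spin_mul_nbrSum_le hL σ x {y, z} (by simp [hy, hσ, hz, hσ'])
  rw [Finset.card_pair hyz] at this
  push_cast at this
  rw [energy_flip]
  nlinarith

lemma energy_flip_allMinus (hL : 2 ≤ L) (J h : ℝ) (x : Site L) :
    energy J h (flip (allMinus L) x) = energy J h (allMinus L) + (3 * J - h) := by
  classical
  have h1 : ∀ y, spin (allMinus L) y = -1 := fun y => by simp [spin, allMinus]
  have : nbrSum (allMinus L) x = -3 := by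
    simp only [nbrSum, h1, ← Finset.sum_filter, Finset.sum_const, card_filter_adj hL x]
    norm_num
  rw [energy_flip, this, h1]
  ring

end Energy

/-! ### Flip paths of bounded height and improvable configurations -/

section Paths

variable {L : ℕ} [NeZero L]

/-- A spin flip between two configurations of energy at most `c`. -/
def FlipBelow (J h c : ℝ) (σ η : Config L) : Prop :=
  (∃ x, η = flip σ x) ∧ energy J h σ ≤ c ∧ energy J h η ≤ c

/-- `η` can be reached from `σ` by spin flips without exceeding the energy `c`. -/
def Reach (J h c : ℝ) : Config L → Config L → Prop := Relation.ReflTransGen (FlipBelow J h c)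

lemma Reach.mono {J h c c' : ℝ} (hc : c ≤ c') {σ η : Config L} (H : Reach J h c σ η) :
    Reach J h c' σ η :=
  Relation.ReflTransGen.mono (fun _ _ ⟨h1, h2, h3⟩ => ⟨h1, h2.trans hc, h3.trans hc⟩) _ _ H

lemma Reach.flip {J h c : ℝ} {σ η : Config L} (H : Reach J h c σ η) (x : Site L)
    (h1 : energy J h η ≤ c) (h2 : energy J h (flip η x) ≤ c) : Reach J h c σ (flip η x) :=
  Relation.ReflTransGen.tail H ⟨⟨x, rfl⟩, h1, h2⟩

lemma Reach.comp {J h c : ℝ} {σ η : Config L} (φ : hexTorus L ≃g hexTorus L)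
    (H : Reach J h c σ η) : Reach J h c (σ ∘ φ) (η ∘ φ) := by
  induction H with
  | refl => exact .refl
  | tail _ h1 ih =>
    obtain ⟨⟨x, rfl⟩, h2, h3⟩ := h1
    refine ih.tail ⟨⟨φ.symm x, ?_⟩, ?_, ?_⟩
    · rw [flip_comp]; simp
    · rwa [energy_comp]
    · rwa [energy_comp]

/-- From `σ` one can reach, at height at most `2 J` above `σ`, a configuration of lower energy, or of
the same energy and larger magnetization. -/
def Improves (J h : ℝ) (σ : Config L) : Prop :=
  ∃ η, Reach J h (energy J h σ + 2 * J) σ η ∧ (energy J h η < energy J h σ ∨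
    energy J h η ≤ energy J h σ ∧ magnetization σ < magnetization η)

lemma Improves.of_comp {J h : ℝ} {σ : Config L} (φ : hexTorus L ≃g hexTorus L)
    (H : Improves J h (σ ∘ φ)) : Improves J h σ := by
  obtain ⟨η, h1, h2⟩ := H
  have key : ∀ ζ : Config L, (ζ ∘ φ) ∘ φ.symm = ζ := fun ζ => by
    funext x; simp
  refine ⟨η ∘ φ.symm, ?_, ?_⟩
  · have := h1.comp φ.symm
    rwa [key, energy_comp] at this
  · rwa [energy_comp, magnetization_comp, ← energy_comp J h σ φ, ← magnetization_comp σ φ]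

/-- The configuration obtained by flipping `x 0, …, x (k - 1)`. -/
def flips (σ : Config L) (x : ℕ → Site L) : ℕ → Config L
  | 0 => σ
  | k + 1 => flip (flips σ x k) (x k)

omit [NeZero L] in
lemma flips_apply_of_ne (σ : Config L) (x : ℕ → Site L) (k : ℕ) (z : Site L)
    (hz : ∀ i < k, z ≠ x i) : flips σ x k z = σ z := by
  induction k with
  | zero => rfl
  | succ k ih =>
    rw [flips, flip_apply_ne _ (hz k (by lia)), ih fun i hi => hz i (by lia)]

omit [NeZero L] in
lemma flips_apply (σ : Config L) (x : ℕ → Site L) (k : ℕ)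
    (hx : ∀ i < k, ∀ j < k, x i = x j → i = j) (i : ℕ) (hi : i < k) :
    flips σ x k (x i) = -σ (x i) := by
  induction k with
  | zero => lia
  | succ k ih =>
    rw [flips]
    by_cases hik : i = k
    · subst hik
      rw [flip_apply_self, flips_apply_of_ne]
      intro j hj e
      have := hx i (by lia) j (by lia) e
      lia
    · rw [flip_apply_ne, ih (fun i hi j hj => hx i (by lia) j (by lia)) (by lia)]
      intro e
      exact hik (hx i (by lia) k (by lia) e)

/-- Flipping one by one the sites of a path on which the spin is constant. The integer `w k` bounds
the change in the number of unsatisfied bonds after `k` flips. -/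
lemma flips_chain (hL : 2 ≤ L) {J h c : ℝ} (hJ : 0 ≤ J) (σ : Config L) (x : ℕ → Site L) (m : ℕ)
    (s : ℤˣ) (hx : ∀ i < m, ∀ j < m, x i = x j → i = j) (hs : ∀ i < m, σ (x i) = s)
    (hadj : ∀ i, i + 1 < m → (hexTorus L).Adj (x (i + 1)) (x i)) (w : ℕ → ℤ) (hw0 : w 0 = 0)
    (hw : ∀ k < m, (k ≠ 0 ∧ w (k + 1) = w k + 1) ∨
      ∃ y, (hexTorus L).Adj (x k) y ∧ σ y = -s ∧
        ((k = 0 ∧ w (k + 1) = w k + 1) ∨ (k ≠ 0 ∧ w (k + 1) = w k - 1)))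
    (hc : ∀ k ≤ m, energy J h σ + w k * J + k * ((s : ℤ) : ℝ) * h ≤ c) (k : ℕ) (hk : k ≤ m) :
    Reach J h c σ (flips σ x k) ∧
      energy J h (flips σ x k) ≤ energy J h σ + w k * J + k * ((s : ℤ) : ℝ) * h ∧
      magnetization (flips σ x k) = magnetization σ - 2 * k * ((s : ℤ) : ℝ) := by
  have hss : s ≠ -s := by
    rcases Int.units_eq_one_or s with hx | hx <;> rw [hx] <;> decide
  induction k with
  | zero => exact ⟨.refl, by simp [flips, hw0], by simp [flips]⟩
  | succ k ih =>
    obtain ⟨h1, h2, h3⟩ := ih (by lia)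
    have hxk : flips σ x k (x k) = s := by
      rw [flips_apply_of_ne, hs k hk]
      intro j hj e
      have := hx k (by lia) j (by lia) e
      lia
    have hsp : spin (flips σ x k) (x k) = ((s : ℤ) : ℝ) := by rw [spin, hxk]
    -- The site flipped just before is already a disagreeing neighbour. One more from outside the
    -- path, when there is one, turns the cost $+J$ into $-J$.
    have hprev : k ≠ 0 → (hexTorus L).Adj (x k) (x (k - 1)) ∧ flips σ x k (x (k - 1)) = -s := by
      intro h0
      obtain ⟨j, rfl⟩ := Nat.exists_eq_succ_of_ne_zero h0
      refine ⟨hadj j hk, ?_⟩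
      rw [Nat.succ_eq_add_one, Nat.add_sub_cancel,
        flips_apply σ x (j + 1) (fun i hi j hj => hx i (by lia) j (by lia)) j (by lia), hs j (by lia)]
    have hy' : ∀ y, σ y = -s → ∀ i < m, y ≠ x i := by
      rintro y hy i hi rfl
      rw [hs i hi] at hy
      exact hss hy
    have hE : energy J h (flips σ x (k + 1)) ≤
        energy J h σ + w (k + 1) * J + (k + 1 : ℕ) * ((s : ℤ) : ℝ) * h := by
      rw [flips]
      rcases hw k hk with ⟨h0, hwk⟩ | ⟨y, hy1, hy2, ⟨h0, hwk⟩ | ⟨h0, hwk⟩⟩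
      · have := energy_flip_le_one hL hJ h (σ := flips σ x k) (hprev h0).1 (by rw [(hprev h0).2, hxk]; exact hss.symm)
        rw [hsp] at this
        rw [hwk]; push_cast; linarith
      · have hyk : flips σ x k y = -s := by
          rw [flips_apply_of_ne σ x k y fun i hi => hy' y hy2 i (by lia), hy2]
        have := energy_flip_le_one hL hJ h (σ := flips σ x k) hy1 (by rw [hyk, hxk]; exact hss.symm)
        rw [hsp] at this
        rw [hwk]; push_cast; linarith
      · have hyk : flips σ x k y = -s := by
          rw [flips_apply_of_ne σ x k y fun i hi => hy' y hy2 i (by lia), hy2]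
        have := energy_flip_le_two hL hJ h (σ := flips σ x k) (hy' y hy2 (k - 1) (by lia)) hy1
          (by rw [hyk, hxk]; exact hss.symm) (hprev h0).1
          (by rw [(hprev h0).2, hxk]; exact hss.symm)
        rw [hsp] at this
        rw [hwk]; push_cast; linarith
    refine ⟨?_, hE, ?_⟩
    · exact h1.flip _ (h2.trans (hc k (by lia))) (hE.trans (hc (k + 1) hk))
    · rw [flips, magnetization_flip, hsp, h3]
      push_cast; ring

end Paths

/-! ### Energy profile of filling or emptying one row of faces -/

section Rows

variable {L : ℕ} [NeZero L]

/-- The faces of the row `b`, read from right to left from the upper-pointing face `(a, b)`. -/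
def row (a b : ZMod L) (k : ℕ) : Site L :=
  if Even k then .inl (a - (k / 2 : ℕ), b) else .inr (a - ((k + 1) / 2 : ℕ), b)

omit [NeZero L] in
lemma row_even (a b : ZMod L) (i : ℕ) : row a b (2 * i) = .inl (a - i, b) := by
  simp [row]

omit [NeZero L] in
lemma row_odd (a b : ZMod L) (i : ℕ) : row a b (2 * i + 1) = .inr (a - (i + 1 : ℕ), b) := by
  have : (2 * i + 1 + 1) / 2 = i + 1 := by lia
  rw [row, if_neg (by simp), this]

omit [NeZero L] in
lemma natCast_inj_of_lt {i j : ℕ} (hi : i < L) (hj : j < L) (e : (i : ZMod L) = j) : i = j := by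
  rw [ZMod.natCast_eq_natCast_iff] at e
  exact Nat.ModEq.eq_of_lt_of_lt e hi hj

omit [NeZero L] in
lemma row_injective (a b : ZMod L) (i j : ℕ) (hi : i < 2 * L) (hj : j < 2 * L)
    (e : row a b i = row a b j) : i = j := by
  rcases Nat.even_or_odd' i with ⟨i, rfl | rfl⟩ <;> rcases Nat.even_or_odd' j with ⟨j, rfl | rfl⟩ <;>
    simp only [row_even, row_odd, Sum.inl.injEq, Sum.inr.injEq, Prod.mk.injEq, and_true,
      sub_right_inj, reduceCtorEq] at e
  · have := natCast_inj_of_lt (by lia) (by lia) e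
    lia
  · push_cast at e
    have := natCast_inj_of_lt (by lia) (by lia) (add_right_cancel e)
    lia

omit [NeZero L] in
lemma row_adj (a b : ZMod L) (i : ℕ) : (hexTorus L).Adj (row a b (i + 1)) (row a b i) := by
  rcases Nat.even_or_odd' i with ⟨i, rfl | rfl⟩
  · rw [row_even, row_odd, adj_inr_inl]
    right; left
    push_cast
    rw [sub_sub]
  · rw [row_odd, show 2 * i + 1 + 1 = 2 * (i + 1) by ring, row_even, adj_inl_inr]
    exact Or.inl rfl

/-- Filling the row of faces along a straight side of length `n` of the plus phase. -/
lemma grow_row (hL : 2 ≤ L) {J h c : ℝ} (hJ : 0 ≤ J) (hh : 0 ≤ h) (hhJ : h ≤ J) (σ : Config L)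
    (a b : ZMod L) (n : ℕ) (hn : 1 ≤ n) (hnL : n ≤ L)
    (hbelow : ∀ i < n, σ (.inr (a - i, b - 1)) = 1) (hup : ∀ i < n, σ (.inl (a - i, b)) = -1)
    (hdown : ∀ i, i + 1 < n → σ (.inr (a - (i + 1 : ℕ), b)) = -1)
    (hc : energy J h σ + 2 * J - 2 * h ≤ c) :
    Reach J h c σ (flips σ (row a b) (2 * n - 1)) ∧
      energy J h (flips σ (row a b) (2 * n - 1)) ≤ energy J h σ + J - (2 * n - 1) * h ∧
      magnetization (flips σ (row a b) (2 * n - 1)) = magnetization σ + 2 * (2 * n - 1) := by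
  have := flips_chain hL (c := c) (h := h) hJ σ (row a b) (2 * n - 1) (-1)
    (fun i hi j hj => row_injective a b i j (by lia) (by lia)) ?_ (fun i _ => row_adj a b i)
    -- The profile is $0,1,2,1,2,\dots,1$: upper-pointing faces rest on a plus face below,
    -- lower-pointing ones lean only on their predecessor. The peak is $2J-2h$, at the second flip.
    (fun k => if k = 0 then 0 else if Even k then 2 else 1) (by simp) ?_ ?_ (2 * n - 1) le_rfl
  · obtain ⟨h1, h2, h3⟩ := this
    have e : ((2 * n - 1 : ℕ) : ℝ) = 2 * n - 1 := by
      rw [Nat.cast_sub (by lia)]; push_cast; ring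
    refine ⟨h1, ?_, ?_⟩
    · rw [if_neg (by lia), if_neg (by rw [Nat.not_even_iff_odd]; exact ⟨n - 1, by lia⟩), e] at h2
      push_cast at h2
      linarith
    · rw [h3, e]; push_cast; ring
  · intro i hi
    rcases Nat.even_or_odd' i with ⟨i, rfl | rfl⟩
    · rw [row_even]; exact hup i (by lia)
    · rw [row_odd]; exact hdown i (by lia)
  · intro k hk
    rcases Nat.even_or_odd' k with ⟨i, rfl | rfl⟩
    · right
      refine ⟨.inr (a - i, b - 1), ?_, ?_, ?_⟩
      · rw [row_even, adj_inl_inr]; simp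
      · rw [hbelow i (by lia)]; simp
      · rcases Nat.eq_zero_or_pos i with rfl | hi
        · simp
        · right
          simp [hi.ne']
    · left
      have : Even (2 * i + 1 + 1) := ⟨i + 1, by ring⟩
      simp [this]
  · intro k _
    refine le_trans ?_ hc
    push_cast
    split_ifs with h0 h1
    · subst h0; push_cast; linarith
    · have : (2 : ℝ) ≤ k := by
        obtain ⟨j, rfl⟩ := h1
        exact_mod_cast (by lia : 2 ≤ j + j)
      nlinarith
    · have : (1 : ℝ) ≤ k := by exact_mod_cast Nat.one_le_iff_ne_zero.2 h0
      nlinarith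

/-- Emptying the row of faces inside a straight side of length `n` of the plus phase. -/
lemma shrink_row (hL : 2 ≤ L) {J h c : ℝ} (hh : 0 ≤ h) (hhJ : h ≤ J) (σ : Config L)
    (a b : ZMod L) (n : ℕ) (hnL : n < L)
    (hup : ∀ i ≤ n, σ (.inl (a - i, b)) = 1) (hdown : ∀ i < n, σ (.inr (a - (i + 1 : ℕ), b)) = 1)
    (habove : ∀ i < n, σ (.inl (a - (i + 1 : ℕ), b + 1)) = -1)
    (hright : σ (.inr (a, b)) = -1) (hleft : σ (.inr (a - (n + 1 : ℕ), b)) = -1)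
    (hc : energy J h σ + J + (2 * n - 1) * h ≤ c) :
    Reach J h c σ (flips σ (row a b) (2 * n + 1)) ∧
      energy J h (flips σ (row a b) (2 * n + 1)) ≤ energy J h σ - J + (2 * n + 1) * h := by
  have hJ : 0 ≤ J := hh.trans hhJ
  -- For $n=0$ the single face has minus neighbours on both sides, so its flip costs $-J+h$
  -- directly, outside the general profile.
  rcases Nat.eq_zero_or_pos n with rfl | hn
  · have hup0 := hup 0 le_rfl
    simp only [Nat.cast_zero, sub_zero, zero_add, Nat.cast_one, mul_zero] at hup0 hleft hc ⊢
    have e : flips σ (row a b) 1 = flip σ (.inl (a, b)) := by simp [flips, row]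
    have hne : (Sum.inr (a, b) : Site L) ≠ .inr (a - 1, b) := by
      have : Fact (1 < L) := ⟨hL⟩
      simp [eq_sub_iff_add_eq]
    have h1 := energy_flip_le_two hL hJ h (σ := σ) (x := .inl (a, b)) hne (by simp [adj_inl_inr])
      (by rw [hup0, hright]; decide) (by simp [adj_inl_inr]) (by rw [hup0, hleft]; decide)
    have h2 : spin σ (.inl (a, b)) = 1 := by simp [spin, hup0]
    rw [h2] at h1
    rw [e]
    exact ⟨Reach.flip .refl _ (by linarith) (by linarith), by linarith⟩
  have hn1 : (1 : ℝ) ≤ n := by exact_mod_cast hn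
  have := flips_chain hL (c := c) (h := h) hJ σ (row a b) (2 * n + 1) 1
    (fun i hi j hj => row_injective a b i j (by lia) (by lia)) ?_ (fun i _ => row_adj a b i)
    -- The profile is $0,1,0,1,\dots,0,-1$: lower-pointing faces have a minus face above, and the
    -- last face has a minus face on its left. The peak $J+(2n-1)h$ comes at flip $2n-1$.
    (fun k => if k = 2 * n + 1 then -1 else if Even k then 0 else 1) (by simp) ?_ ?_ (2 * n + 1) le_rfl
  · obtain ⟨h1, h2, -⟩ := this
    refine ⟨h1, ?_⟩
    rw [if_pos rfl] at h2
    push_cast at h2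
    linarith
  · intro i hi
    rcases Nat.even_or_odd' i with ⟨i, rfl | rfl⟩
    · rw [row_even]; exact hup i (by lia)
    · rw [row_odd]; exact hdown i (by lia)
  · intro k hk
    rcases Nat.even_or_odd' k with ⟨i, rfl | rfl⟩
    · rcases Nat.eq_zero_or_pos i with rfl | hi
      · right
        refine ⟨.inr (a, b), ?_, hright, ?_⟩
        · simp [row, adj_inl_inr]
        · simp [hn.ne']
      · rcases eq_or_ne i n with rfl | hin
        · right
          refine ⟨.inr (a - (i + 1 : ℕ), b), ?_, hleft, ?_⟩
          · rw [row_even, adj_inl_inr]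
            right; left
            push_cast
            rw [sub_sub]
          · right
            simp [hi.ne']
        · left
          simp [hi.ne', hin, show 2 * i ≠ 2 * n + 1 by lia]
    · right
      refine ⟨.inl (a - (i + 1 : ℕ), b + 1), ?_, habove i (by lia), ?_⟩
      · rw [row_odd, adj_inr_inl]
        simp
      · have h1 : Even (2 * i + 1 + 1) := ⟨i + 1, by ring⟩
        have h2 : 2 * i + 1 ≠ 2 * n := by lia
        simp [h1, h2, show i ≠ n by lia]
  · intro k hk
    refine le_trans ?_ hc
    rcases eq_or_ne k (2 * n + 1) with rfl | hkn
    · simp; nlinarith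
    · rcases Nat.even_or_odd' k with ⟨i, rfl | rfl⟩
      · have : (i : ℝ) ≤ n := by exact_mod_cast (by lia : i ≤ n)
        simp [hkn]; nlinarith
      · have : (i : ℝ) + 1 ≤ n := by exact_mod_cast (by lia : i + 1 ≤ n)
        simp [show i ≠ n by lia]; nlinarith

end Rows

/-! ### Lattice symmetries -/

section Automorphisms

variable {L : ℕ}

/-- Translations of the torus. -/
def translation (v : ZMod L × ZMod L) : hexTorus L ≃g hexTorus L where
  toEquiv := Equiv.sumCongr (Equiv.addRight v) (Equiv.addRight v)
  map_rel_iff' := by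
    obtain ⟨p, q⟩ := v
    rintro (⟨a, b⟩ | ⟨a, b⟩) (⟨c, d⟩ | ⟨c, d⟩) <;>
      simp [adj_inl_inr, adj_inr_inl, not_adj_inl_inl, not_adj_inr_inr, -Prod.mk_add_mk,
        Prod.ext_iff] <;> grind

/-- The rotation by 60 degrees around the vertex `(0, 0)`. -/
def rotation : hexTorus L ≃g hexTorus L where
  toFun
    | .inl (a, b) => .inr (-b - 1, a + b)
    | .inr (a, b) => .inl (-b - 1, a + b + 1)
  invFun
    | .inl (a, b) => .inr (a + b, -a - 1)
    | .inr (a, b) => .inl (a + b + 1, -a - 1)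
  left_inv := by rintro (⟨a, b⟩ | ⟨a, b⟩) <;> simp; ring
  right_inv := by rintro (⟨a, b⟩ | ⟨a, b⟩) <;> simp; ring
  map_rel_iff' := by
    rintro (⟨a, b⟩ | ⟨a, b⟩) (⟨c, d⟩ | ⟨c, d⟩) <;>
      simp [adj_inl_inr, adj_inr_inl, not_adj_inl_inl, not_adj_inr_inr] <;> grind

/-- The reflection fixing the vertex `(0, 0)` and the direction of the second axis. -/
def reflection : hexTorus L ≃g hexTorus L where
  toFun
    | .inl (a, b) => .inr (-a - 1, a + b)
    | .inr (a, b) => .inl (-a - 1, a + b + 1)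
  invFun
    | .inl (a, b) => .inr (-a - 1, a + b)
    | .inr (a, b) => .inl (-a - 1, a + b + 1)
  left_inv := by rintro (⟨a, b⟩ | ⟨a, b⟩) <;> simp; ring
  right_inv := by rintro (⟨a, b⟩ | ⟨a, b⟩) <;> simp; ring
  map_rel_iff' := by
    rintro (⟨a, b⟩ | ⟨a, b⟩) (⟨c, d⟩ | ⟨c, d⟩) <;>
      simp [adj_inl_inr, adj_inr_inl, not_adj_inl_inl, not_adj_inr_inr] <;> grind

lemma translation_inl (v u : ZMod L × ZMod L) : translation v (.inl u) = .inl (u + v) := rfl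
lemma translation_inr (v u : ZMod L × ZMod L) : translation v (.inr u) = .inr (u + v) := rfl
lemma rotation_inl (a b : ZMod L) : rotation (.inl (a, b)) = .inr (-b - 1, a + b) := rfl
lemma rotation_inr (a b : ZMod L) : rotation (.inr (a, b)) = .inl (-b - 1, a + b + 1) := rfl

end Automorphisms

/-! ### Local structure of configurations that cannot be improved -/

section Traps

variable {L : ℕ} [NeZero L] {J h : ℝ}

omit [NeZero L] in
lemma eq_neg_one_of_ne_one {u : ℤˣ} (h : u ≠ 1) : u = -1 := (Int.units_eq_one_or u).resolve_left h

/-- In a configuration that cannot be improved a spin disagrees with at most one neighbour. -/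
lemma eq_of_not_improves (hL : 2 ≤ L) (hh : 0 < h) (hhJ : h < J) {σ : Config L}
    (hσ : ¬ Improves J h σ) {x y z : Site L} (hyz : y ≠ z) (hy : (hexTorus L).Adj x y)
    (hz : (hexTorus L).Adj x z) (hxy : σ y ≠ σ x) : σ z = σ x := by
  by_contra hxz
  have := energy_flip_le_two hL (hh.trans hhJ).le h hyz hy hxy hz hxz
  have hs : spin σ x ≤ 1 := by rcases spin_eq_one_or σ x with e | e <;> rw [e]; norm_num
  have hlt : energy J h (flip σ x) < energy J h σ := by nlinarith
  exact hσ ⟨_, Reach.flip .refl x (by linarith) (by linarith), Or.inl hlt⟩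

/-- In a configuration that cannot be improved, of two adjacent minus spins one has no plus
neighbour. -/
lemma no_plus_neighbour (hL : 2 ≤ L) (hh : 0 < h) (hhJ : h < J) {σ : Config L}
    (hσ : ¬ Improves J h σ) {x y x' y' : Site L} (hxy : (hexTorus L).Adj x y)
    (hx : σ x = -1) (hy : σ y = -1) (hxx' : (hexTorus L).Adj x x') (hyy' : (hexTorus L).Adj y y')
    (hy' : σ y' = 1) : σ x' = -1 := by
  refine eq_neg_one_of_ne_one fun hx' => hσ ?_
  have hxs : spin σ x = -1 := by simp [spin, hx]
  have h1 := energy_flip_le_one hL (hh.trans hhJ).le h (σ := σ) hxx' (by rw [hx, hx']; decide)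
  have hyx : y ≠ x := hxy.symm.ne
  have hy'x : y' ≠ x := by rintro rfl; rw [hx] at hy'; exact absurd hy' (by decide)
  have e1 : flip σ x y = -1 := by rw [flip_apply_ne _ hyx, hy]
  have e2 : flip σ x y' = 1 := by rw [flip_apply_ne _ hy'x, hy']
  have e3 : flip σ x x = 1 := by rw [flip_apply_self, hx]; decide
  -- Once `x` is plus, `y` has the two plus neighbours `x` and `y'`: the costs $J-h$ and $-J-h$ add
  -- up to $-2h$.
  have h2 := energy_flip_le_two hL (hh.trans hhJ).le h (σ := flip σ x) hy'x hyy'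
    (by rw [e1, e2]; decide) hxy.symm (by rw [e1, e3]; decide)
  have hys : spin (flip σ x) y = -1 := by simp [spin, e1]
  rw [hxs] at h1
  rw [hys] at h2
  exact ⟨_, (Reach.flip .refl x (by linarith) (by linarith)).flip y (by linarith) (by linarith),
    Or.inl (by linarith)⟩

/-- The horizontal edge below the face `(a, b)` separates a plus face below from a minus face
above. -/
def IsTop (σ : Config L) (a b : ZMod L) : Prop := σ (.inr (a, b - 1)) = 1 ∧ σ (.inl (a, b)) = -1

lemma IsTop.around (hL : 2 ≤ L) (hh : 0 < h) (hhJ : h < J) {σ : Config L}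
    (hσ : ¬ Improves J h σ) {a b : ZMod L} (H : IsTop σ a b) :
    σ (.inr (a, b)) = -1 ∧ σ (.inr (a - 1, b)) = -1 ∧ σ (.inl (a + 1, b)) = -1 ∧
      σ (.inl (a - 1, b)) = -1 ∧ σ (.inl (a, b - 1)) = 1 ∧ σ (.inl (a + 1, b - 1)) = 1 := by
  have : Fact (1 < L) := ⟨hL⟩
  obtain ⟨h1, h2⟩ := H
  have hne : σ (.inr (a, b - 1)) ≠ σ (.inl (a, b)) := by rw [h1, h2]; decide
  have k1 : σ (.inr (a, b)) = -1 := by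
    rw [← h2]
    exact eq_of_not_improves hL hh hhJ hσ (y := .inr (a, b - 1)) (by simp)
      (by simp [adj_inl_inr]) (by simp [adj_inl_inr]) hne
  have k2 : σ (.inr (a - 1, b)) = -1 := by
    rw [← h2]
    exact eq_of_not_improves hL hh hhJ hσ (y := .inr (a, b - 1)) (by simp)
      (by simp [adj_inl_inr]) (by simp [adj_inl_inr]) hne
  refine ⟨k1, k2, ?_, ?_, ?_, ?_⟩
  · exact no_plus_neighbour hL hh hhJ hσ (x := .inr (a, b)) (y := .inl (a, b)) (y' := .inr (a, b - 1))
      (by simp [adj_inr_inl]) k1 h2 (by simp [adj_inr_inl]) (by simp [adj_inl_inr]) h1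
  · exact no_plus_neighbour hL hh hhJ hσ (x := .inr (a - 1, b)) (y := .inl (a, b))
      (y' := .inr (a, b - 1)) (by simp [adj_inr_inl]) k2 h2 (by simp [adj_inr_inl])
      (by simp [adj_inl_inr]) h1
  · rw [← h1]
    exact eq_of_not_improves hL hh hhJ hσ (y := .inl (a, b)) (by simp [eq_sub_iff_add_eq])
      (by simp [adj_inr_inl]) (by simp [adj_inr_inl]) hne.symm
  · rw [← h1]
    exact eq_of_not_improves hL hh hhJ hσ (y := .inl (a, b)) (by simp [eq_sub_iff_add_eq])
      (by simp [adj_inr_inl]) (by simp [adj_inr_inl]) hne.symm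

/-- A side of the plus phase going around the torus can be improved. -/
lemma exists_not_isTop (hL : 2 ≤ L) (hh : 0 < h) (hhJ : h < J) {σ : Config L}
    (hσ : ¬ Improves J h σ) (b : ZMod L) : ∃ a, ¬ IsTop σ a b := by
  by_contra! H
  have hJ := (hh.trans hhJ).le
  obtain ⟨h1, h2, -⟩ := grow_row (c := energy J h σ + 2 * J) hL hJ hh.le hhJ.le σ 0 b L (by lia) le_rfl (fun i _ => (H _).1)
    (fun i _ => (H _).2) (fun i _ => ((H _).around hL hh hhJ hσ).1) (by linarith)
  set η := flips σ (row 0 b) (2 * L - 1) with hη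
  have hinj : ∀ i < 2 * L - 1, ∀ j < 2 * L - 1, row (0 : ZMod L) b i = row 0 b j → i = j :=
    fun i hi j hj => row_injective 0 b i j (by lia) (by lia)
  have e0 : η (.inl (0, b)) = 1 := by
    have := flips_apply σ (row 0 b) (2 * L - 1) hinj 0 (by lia)
    simp only [row, Even.zero, if_true, Nat.zero_div, Nat.cast_zero, sub_zero] at this
    rw [hη, this, (H 0).2]; decide
  have e1 : η (.inl (1, b)) = 1 := by
    have := flips_apply σ (row 0 b) (2 * L - 1) hinj (2 * (L - 1)) (by lia)
    have hc : (0 : ZMod L) - (L - 1 : ℕ) = 1 := by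
      rw [Nat.cast_sub (by lia)]; simp
    rw [row_even, hc] at this
    rw [hη, this, (H 1).2]; decide
  have e2 : η (.inr (0, b)) = -1 := by
    rw [hη, flips_apply_of_ne, ((H 0).around hL hh hhJ hσ).1]
    intro i hi
    rcases Nat.even_or_odd' i with ⟨i, rfl | rfl⟩
    · simp [row_even]
    · rw [row_odd]
      intro e
      simp only [Sum.inr.injEq, Prod.mk.injEq, and_true, zero_sub] at e
      have : ((0 : ℕ) : ZMod L) = ((i + 1 : ℕ) : ZMod L) := by
        rw [Nat.cast_zero]; exact (neg_eq_zero.1 e.symm).symm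
      have := natCast_inj_of_lt (by lia) (by lia) this
      lia
  have : Fact (1 < L) := ⟨hL⟩
  -- The one face of the row still unflipped now lies between two plus faces. Flipping it costs
  -- $-J-h$ and brings the total to $-2Lh<0$.
  have h3 := energy_flip_le_two hL hJ h (σ := η) (x := .inr (0, b)) (y := .inl (0, b))
    (z := .inl (1, b)) (by simp) (by simp [adj_inr_inl]) (by rw [e0, e2]; decide)
    (by simp [adj_inr_inl]) (by rw [e1, e2]; decide)
  have hs : spin η (.inr (0, b)) = -1 := by simp [spin, e2]
  rw [hs] at h3
  have hLR : (2 : ℝ) ≤ L := by exact_mod_cast hL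
  exact hσ ⟨_, h1.flip (.inr (0, b)) (by nlinarith) (by nlinarith), Or.inl (by nlinarith)⟩

end Traps

/-! ### Sides between two convex corners and their critical length -/

section Corners

variable {L : ℕ} [NeZero L] {J h : ℝ}

/-- The side of length `n` of the plus phase that ends, on the right, at a convex corner at the
vertex `(0, 0)` and, on the left, at another convex corner. -/
structure IsSide (σ : Config L) (n : ℕ) : Prop where
  one_le : 1 ≤ n
  lt : n < L
  isTop : ∀ i < n, IsTop σ (-1 - i) 0
  right : σ (.inr (0, -1)) = -1
  left : σ (.inr (-1 - n, -1)) = -1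

/-- The side is followed to the left until it stops; by `IsTop.around` the face above its
continuation is minus at either end, so it can stop only because the face below is minus too. -/
lemma exists_isSide (hL : 2 ≤ L) (hh : 0 < h) (hhJ : h < J) {σ : Config L}
    (hσ : ¬ Improves J h σ) (H : IsTop σ (-1) 0) (H0 : ¬ IsTop σ 0 0) : ∃ n, IsSide σ n := by
  classical
  -- In `ZMod L`, $-1-(L-1)=0$: after a full turn the search meets the edge where `IsTop` fails.
  have hex : ∃ n : ℕ, ¬ IsTop σ (-1 - n) 0 := ⟨L - 1, by
    rw [Nat.cast_sub (by lia)]; simpa using H0⟩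
  have hlt : Nat.find hex < L := by
    have : Nat.find hex ≤ L - 1 := Nat.find_min' hex (by
      rw [Nat.cast_sub (by lia)]; simpa using H0)
    lia
  have hpos : 1 ≤ Nat.find hex := by
    rw [Nat.one_le_iff_ne_zero]
    intro e
    have := Nat.find_spec hex
    rw [e] at this
    simp [H] at this
  have htop : ∀ i < Nat.find hex, IsTop σ (-1 - i) 0 := fun i hi => not_not.1 (Nat.find_min hex hi)
  refine ⟨Nat.find hex, hpos, hlt, htop, ?_, ?_⟩
  · have h1 := (H.around hL hh hhJ hσ).2.2.1
    rw [neg_add_cancel] at h1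
    refine eq_neg_one_of_ne_one fun h2 => H0 ⟨by simpa using h2, h1⟩
  · have h1 := ((htop (Nat.find hex - 1) (by lia)).around hL hh hhJ hσ).2.2.2.1
    have e : (-1 : ZMod L) - (Nat.find hex - 1 : ℕ) - 1 = -1 - Nat.find hex := by
      rw [Nat.cast_sub hpos]; push_cast; ring
    rw [e] at h1
    have h2 := Nat.find_spec hex
    refine eq_neg_one_of_ne_one fun h3 => h2 ⟨by simpa using h3, h1⟩

lemma IsSide.grow (hL : 2 ≤ L) (hh : 0 < h) (hhJ : h < J) {σ : Config L}
    (hσ : ¬ Improves J h σ) {n : ℕ} (H : IsSide σ n) :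
    Reach J h (energy J h σ + 2 * J) σ (flips σ (row (-1) 0) (2 * n - 1)) ∧
      energy J h (flips σ (row (-1) 0) (2 * n - 1)) ≤ energy J h σ + J - (2 * n - 1) * h ∧
      magnetization (flips σ (row (-1) 0) (2 * n - 1)) = magnetization σ + 2 * (2 * n - 1) := by
  refine grow_row hL (hh.trans hhJ).le hh.le hhJ.le σ (-1) 0 n H.one_le H.lt.le (fun i hi => (H.isTop i hi).1)
    (fun i hi => (H.isTop i hi).2) (fun i hi => ?_) (by linarith)
  exact ((H.isTop (i + 1) hi).around hL hh hhJ hσ).1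

lemma IsSide.plus_up (hL : 2 ≤ L) (hh : 0 < h) (hhJ : h < J) {σ : Config L}
    (hσ : ¬ Improves J h σ) {n : ℕ} (H : IsSide σ n) (i : ℕ) (hi : i ≤ n) :
    σ (.inl (0 - i, -1)) = 1 := by
  rcases Nat.eq_zero_or_pos i with rfl | hi0
  · have := ((H.isTop 0 H.one_le).around hL hh hhJ hσ).2.2.2.2.2
    simpa using this
  · have := ((H.isTop (i - 1) (by lia)).around hL hh hhJ hσ).2.2.2.2.1
    have e : (-1 : ZMod L) - (i - 1 : ℕ) = 0 - i := by
      rw [Nat.cast_sub hi0]; push_cast; ring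
    simpa [e] using this

omit [NeZero L] in
lemma IsSide.plus_down {σ : Config L} {n : ℕ} (H : IsSide σ n) (i : ℕ) (hi : i < n) :
    σ (.inr (0 - (i + 1 : ℕ), -1)) = 1 := by
  have := (H.isTop i hi).1
  have e : (-1 : ZMod L) - i = 0 - (i + 1 : ℕ) := by push_cast; ring
  simpa [e] using this

omit [NeZero L] in
lemma IsSide.minus_up {σ : Config L} {n : ℕ} (H : IsSide σ n) (i : ℕ) (hi : i < n) :
    σ (.inl (0 - (i + 1 : ℕ), 0)) = -1 := by
  have := (H.isTop i hi).2
  have e : (-1 : ZMod L) - i = 0 - (i + 1 : ℕ) := by push_cast; ring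
  simpa [e] using this

lemma IsSide.shrink (hL : 2 ≤ L) (hh : 0 < h) (hhJ : h < J) {σ : Config L}
    (hσ : ¬ Improves J h σ) {n : ℕ} (H : IsSide σ n) (hn : (2 * n - 1) * h ≤ J) :
    Reach J h (energy J h σ + 2 * J) σ (flips σ (row 0 (-1)) (2 * n + 1)) ∧
      energy J h (flips σ (row 0 (-1)) (2 * n + 1)) ≤ energy J h σ - J + (2 * n + 1) * h := by
  refine shrink_row hL hh.le hhJ.le σ 0 (-1) n H.lt (H.plus_up hL hh hhJ hσ) H.plus_down
    (fun i hi => ?_) H.right ?_ (by linarith)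
  · simpa using H.minus_up i hi
  · have := H.left
    have e : (-1 : ZMod L) - n = 0 - (n + 1 : ℕ) := by push_cast; ring
    rwa [e] at this

/-- If either inequality failed, filling or emptying a row would lower the energy. The excluded
values of $J/(2h)-1/2$ are exactly the cases of equality. -/
lemma IsSide.critical (hL : 2 ≤ L) (hh : 0 < h) (hhJ : h < J)
    (hJh : ∀ k : ℤ, J / (2 * h) - 1 / 2 ≠ k) {σ : Config L}
    (hσ : ¬ Improves J h σ) {n : ℕ} (H : IsSide σ n) :
    (2 * n - 1) * h < J ∧ J < (2 * n + 1) * h := by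
  have key : ∀ k : ℤ, J ≠ (2 * k + 1) * h := fun k e => hJh k (by rw [e]; field_simp; ring)
  have h1 : (2 * n - 1) * h ≤ J := by
    by_contra! hlt
    obtain ⟨h1, h2, -⟩ := H.grow hL hh hhJ hσ
    exact hσ ⟨_, h1, Or.inl (by linarith)⟩
  refine ⟨lt_of_le_of_ne h1 fun e => key (n - 1) ?_, ?_⟩
  · rw [← e]; push_cast; ring
  · by_contra! hle
    have hlt := lt_of_le_of_ne hle fun e => key n (by rw [← e]; push_cast; ring)
    obtain ⟨h2, h3⟩ := H.shrink hL hh hhJ hσ h1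
    exact hσ ⟨_, h2, Or.inl (by linarith)⟩

end Corners

/-! ### Moving two adjacent sides at once -/

section TwoSides

variable {L : ℕ} [NeZero L] {J h : ℝ}

lemma energy_comp_reflection (σ : Config L) :
    energy J h (σ ∘ reflection) = energy J h σ := energy_comp J h σ reflection

omit [NeZero L] in
lemma comp_reflection_inl (σ : Config L) (a b : ZMod L) :
    (σ ∘ reflection) (.inl (a, b)) = σ (.inr (-a - 1, a + b)) := rfl

omit [NeZero L] in
lemma comp_reflection_inr (σ : Config L) (a b : ZMod L) :
    (σ ∘ reflection) (.inr (a, b)) = σ (.inl (-a - 1, a + b + 1)) := rfl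

omit [NeZero L] in
lemma natCast_ne_zero {i : ℕ} (h0 : 0 < i) (hi : i < L) : (i : ZMod L) ≠ 0 := by
  intro e
  have := natCast_inj_of_lt (j := 0) hi (by lia) (by simpa using e)
  lia

omit [NeZero L] in
/-- Sites off a row keep their spin when the row is flipped. -/
lemma flips_row_of_ne (σ : Config L) (a b : ZMod L) (k : ℕ) (z : Site L)
    (h1 : ∀ i, 2 * i < k → z ≠ .inl (a - i, b))
    (h2 : ∀ i, 2 * i + 1 < k → z ≠ .inr (a - (i + 1 : ℕ), b)) : flips σ (row a b) k z = σ z := by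
  refine flips_apply_of_ne _ _ _ _ fun i hi => ?_
  rcases Nat.even_or_odd' i with ⟨i, rfl | rfl⟩
  · rw [row_even]; exact h1 i hi
  · rw [row_odd]; exact h2 i hi

/-- A corner between two sides of length `n` with `J ≤ 2 n h` can be improved by filling first the
row along one side and then the longer row along the other. -/
lemma improves_of_grow_grow (hL : 2 ≤ L) (hh : 0 < h) (hhJ : h < J) {σ : Config L}
    (hσ : ¬ Improves J h σ) {n : ℕ} (H : IsSide σ n) (H' : IsSide (σ ∘ reflection) n)
    (hJ2 : J ≤ 2 * n * h) : False := by
  have hσ' : ¬ Improves J h (σ ∘ reflection) := fun h => hσ h.of_comp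
  obtain ⟨h1, h2, h3⟩ := H.grow hL hh hhJ hσ
  have hn := H.one_le
  have hnL := H.lt
  set η := flips σ (row (-1) 0) (2 * n - 1) with hη
  have hplus : ∀ x, σ x = 1 → η x = 1 := by
    intro x hx
    rw [hη, flips_row_of_ne, hx]
    · rintro i hi rfl
      rw [(H.isTop i (by lia)).2] at hx
      exact absurd hx (by decide)
    · rintro i hi rfl
      rw [((H.isTop (i + 1) (by lia)).around hL hh hhJ hσ).1] at hx
      exact absurd hx (by decide)
  have htop' : ∀ i, 1 ≤ i → i ≤ n → IsTop (σ ∘ reflection) (0 - i) 0 := by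
    intro i hi hin
    have := H'.isTop (i - 1) (by lia)
    have e : (-1 : ZMod L) - (i - 1 : ℕ) = 0 - i := by
      rw [Nat.cast_sub hi]; push_cast; ring
    rwa [e] at this
  -- `reflection` exchanges the two sides meeting at the vertex $(0,0)$. The first face filled along
  -- one side lengthens the other by one edge, to $n+1$.
  have hbelow : ∀ i < n + 1, (η ∘ reflection) (.inr (0 - i, 0 - 1)) = 1 := by
    intro i hi
    rcases Nat.eq_zero_or_pos i with rfl | hi0
    · have := flips_apply σ (row (-1) 0) (2 * n - 1)
        (fun i hi j hj => row_injective _ _ i j (by lia) (by lia)) 0 (by lia)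
      have e : row (-1 : ZMod L) 0 0 = .inl (-1, 0) := by simp [row]
      have hm : σ (.inl (-1, 0)) = -1 := by simpa using (H.isTop 0 (by lia)).2
      rw [e, hm] at this
      rw [comp_reflection_inr]
      simpa using this
    · exact hplus _ (htop' i hi0 (by lia)).1
  have hup : ∀ i < n + 1, (η ∘ reflection) (.inl (0 - i, 0)) = -1 := by
    intro i hi
    have hs : (σ ∘ reflection) (.inl (0 - i, 0)) = -1 := by
      rcases Nat.eq_zero_or_pos i with rfl | hi0
      · have := ((H'.isTop 0 (by lia)).around hL hh hhJ hσ').2.2.1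
        simpa using this
      · exact (htop' i hi0 (by lia)).2
    rw [comp_reflection_inl] at hs ⊢
    rw [hη, flips_row_of_ne, hs]
    · intro j hj; simp
    · intro j hj e
      simp only [Sum.inr.injEq, Prod.mk.injEq, zero_sub, neg_neg, add_zero, neg_eq_zero] at e
      rcases Nat.eq_zero_or_pos i with rfl | hi0
      · have e1 := e.1
        rw [Nat.cast_zero, zero_sub, eq_comm, sub_eq_self] at e1
        exact natCast_ne_zero (by lia) (by lia) e1
      · exact natCast_ne_zero hi0 (by lia) e.2
  have hdown : ∀ i, i + 1 < n + 1 → (η ∘ reflection) (.inr (0 - (i + 1 : ℕ), 0)) = -1 := by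
    intro i hi
    have hs : (σ ∘ reflection) (.inr (0 - (i + 1 : ℕ), 0)) = -1 :=
      ((htop' (i + 1) (by lia) (by lia)).around hL hh hhJ hσ').1
    rw [comp_reflection_inr] at hs ⊢
    rw [hη, flips_row_of_ne, hs]
    · intro j hj e
      simp only [Sum.inl.injEq, Prod.mk.injEq] at e
      push_cast at e
      rcases Nat.eq_zero_or_pos i with rfl | hi0
      · refine natCast_ne_zero (L := L) (i := j + 1) (by lia) (by lia) ?_
        have := e.1
        push_cast at this ⊢
        linear_combination this
      · refine natCast_ne_zero (L := L) hi0 (by lia) ?_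
        linear_combination -e.2
    · intro j hj; simp
  -- The second filling starts $J-(2n-1)h$ above `σ` and climbs $2J-2h$; this inequality keeps its
  -- peak within $2J$.
  have hJn : J ≤ (2 * n + 1) * h := by linarith
  obtain ⟨k1, k2, k3⟩ := grow_row hL (hh.trans hhJ).le hh.le hhJ.le (c := energy J h σ + 2 * J)
    (η ∘ reflection) 0 0 (n + 1) (by lia) (by lia) hbelow hup hdown
    (by rw [energy_comp_reflection]; linarith)
  rw [energy_comp_reflection] at k2
  rw [magnetization_comp] at k3
  push_cast at k2 k3
  have hnR : (1 : ℝ) ≤ n := by exact_mod_cast hn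
  generalize flips (η ∘ reflection) _ _ = ζ at k1 k2 k3
  -- The total change $2J-4nh$ may vanish, but the magnetization has strictly increased.
  refine hσ' ⟨ζ, ?_, Or.inr ⟨?_, ?_⟩⟩
  rotate_left
  · rw [energy_comp_reflection]; refine k2.trans ?_; linarith
  · rw [magnetization_comp]; rw [k3]; linarith
  · rw [energy_comp_reflection]
    exact (h1.comp reflection).trans k1

/-- A corner between two sides of length `n` with `2 n h < J` can be improved by emptying first the
row inside one side and then the shorter row inside the other. -/
lemma improves_of_shrink_shrink (hL : 2 ≤ L) (hh : 0 < h) (hhJ : h < J) {σ : Config L}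
    (hσ : ¬ Improves J h σ) {n : ℕ} (H : IsSide σ n) (H' : IsSide (σ ∘ reflection) n)
    (hn1 : (2 * n - 1) * h ≤ J) (hJ2 : 2 * n * h < J) : False := by
  have hσ' : ¬ Improves J h (σ ∘ reflection) := fun h => hσ h.of_comp
  obtain ⟨h1, h2⟩ := H.shrink hL hh hhJ hσ hn1
  have hn := H.one_le
  have hnL := H.lt
  set η := flips σ (row 0 (-1)) (2 * n + 1) with hη
  have hminus : ∀ x, σ x = -1 → η x = -1 := by
    intro x hx
    rw [hη, flips_row_of_ne, hx]
    · rintro i hi rfl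
      rw [H.plus_up hL hh hhJ hσ i (by lia)] at hx
      exact absurd hx (by decide)
    · rintro i hi rfl
      rw [H.plus_down i (by lia)] at hx
      exact absurd hx (by decide)
  have e1 : ∀ i : ℕ, (-1 : ZMod L) - i = 0 - (i + 1 : ℕ) := fun i => by push_cast; ring
  have hup : ∀ i ≤ n - 1, (η ∘ reflection) (.inl (-1 - i, -1)) = 1 := by
    intro i hi
    have hs : (σ ∘ reflection) (.inl (-1 - i, -1)) = 1 := by
      rw [e1]; exact H'.plus_up hL hh hhJ hσ' (i + 1) (by lia)
    rw [comp_reflection_inl] at hs ⊢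
    rw [hη, flips_row_of_ne, hs]
    · intro j hj; simp
    · intro j hj e
      simp only [Sum.inr.injEq, Prod.mk.injEq] at e
      refine natCast_ne_zero (L := L) (i := i + 1) (by lia) (by lia) ?_
      push_cast
      linear_combination -e.2
  have hdown : ∀ i < n - 1, (η ∘ reflection) (.inr (-1 - (i + 1 : ℕ), -1)) = 1 := by
    intro i hi
    have hs : (σ ∘ reflection) (.inr (-1 - (i + 1 : ℕ), -1)) = 1 := by
      rw [e1]; exact H'.plus_down (i + 1) (by lia)
    rw [comp_reflection_inr] at hs ⊢
    rw [hη, flips_row_of_ne, hs]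
    · intro j hj e
      simp only [Sum.inl.injEq, Prod.mk.injEq] at e
      push_cast at e
      refine natCast_ne_zero (L := L) (i := i + 1) (by lia) (by lia) ?_
      push_cast
      linear_combination -e.2
    · intro j hj; simp
  have habove : ∀ i < n - 1, (η ∘ reflection) (.inl (-1 - (i + 1 : ℕ), -1 + 1)) = -1 := by
    intro i hi
    have hs : (σ ∘ reflection) (.inl (-1 - (i + 1 : ℕ), -1 + 1)) = -1 := by
      rw [e1, neg_add_cancel]; exact H'.minus_up (i + 1) (by lia)
    exact hminus _ hs
  -- The corner face emptied with the row of one side shortens the other side to $n-1$, so the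
  -- second row has only $2n-1$ faces.
  have hright : (η ∘ reflection) (.inr (-1, -1)) = -1 := by
    have := flips_apply σ (row 0 (-1)) (2 * n + 1)
      (fun i hi j hj => row_injective _ _ i j (by lia) (by lia)) 0 (by lia)
    have e : row (0 : ZMod L) (-1) 0 = .inl (0, -1) := by simp [row]
    have hp : σ (.inl (0, -1)) = 1 := by simpa using H.plus_up hL hh hhJ hσ 0 (by lia)
    rw [e, hp] at this
    rw [comp_reflection_inr]
    simpa using this
  have hleft : (η ∘ reflection) (.inr (-1 - (n - 1 + 1 : ℕ), -1)) = -1 := by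
    rw [Nat.sub_add_cancel hn]
    exact hminus _ H'.left
  have hnR : ((n - 1 : ℕ) : ℝ) = n - 1 := by rw [Nat.cast_sub hn]; simp
  -- The peak is $(-J+(2n+1)h)+(J+(2n-3)h)=(4n-2)h\le 2J$.
  obtain ⟨k1, k2⟩ := shrink_row hL hh.le hhJ.le (c := energy J h σ + 2 * J)
    (η ∘ reflection) (-1) (-1) (n - 1) (by lia) hup hdown habove hright hleft
    (by rw [energy_comp_reflection, hnR]; linarith)
  rw [energy_comp_reflection, hnR] at k2
  generalize flips (η ∘ reflection) _ _ = ζ at k1 k2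
  refine hσ' ⟨ζ, ?_, Or.inl ?_⟩
  rotate_left
  · rw [energy_comp_reflection]; refine k2.trans_lt ?_; linarith
  · rw [energy_comp_reflection]
    exact (h1.comp reflection).trans k1

end TwoSides

/-! ### Only the constant configurations cannot be improved -/

section Constant

variable {L : ℕ} [NeZero L] {J h : ℝ}

/-- Otherwise the side ends at a convex corner where a second side starts. The critical window has
width $2h$ and determines the length, so both sides have the same one, and moving both is an
improvement. -/
lemma isTop_succ_of_not_improves (hL : 2 ≤ L) (hh : 0 < h) (hhJ : h < J)
    (hJh : ∀ k : ℤ, J / (2 * h) - 1 / 2 ≠ k) {σ : Config L}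
    (hσ : ¬ Improves J h σ) (H : IsTop σ (-1) 0) : IsTop σ 0 0 := by
  by_contra H0
  have hσ' : ¬ Improves J h (σ ∘ reflection) := fun h => hσ h.of_comp
  obtain ⟨n, hn⟩ := exists_isSide hL hh hhJ hσ H H0
  have key : ∃ n', IsSide (σ ∘ reflection) n' := by
    have h1 := (H.around hL hh hhJ hσ).2.2.2.2.2
    refine exists_isSide hL hh hhJ hσ' ⟨?_, ?_⟩ ?_
    · rw [comp_reflection_inr]
      simpa using h1
    · rw [comp_reflection_inl]
      simpa using hn.right
    · rintro ⟨h2, -⟩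
      have h3 := H.2
      rw [comp_reflection_inr] at h2
      simp [h3] at h2
  obtain ⟨n', hn'⟩ := key
  obtain ⟨c1, c2⟩ := hn.critical hL hh hhJ hJh hσ
  obtain ⟨c3, c4⟩ := hn'.critical hL hh hhJ hJh hσ'
  have e : n = n' := by
    have a1 : (2 * n - 1 : ℝ) < 2 * n' + 1 := lt_of_mul_lt_mul_right (c1.trans c4) hh.le
    have a2 : (2 * n' - 1 : ℝ) < 2 * n + 1 := lt_of_mul_lt_mul_right (c3.trans c2) hh.le
    have b1 : (n : ℝ) < n' + 1 := by linarith
    have b2 : (n' : ℝ) < n + 1 := by linarith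
    norm_cast at b1 b2
    lia
  subst e
  rcases le_or_gt J (2 * n * h) with h1 | h1
  · exact improves_of_grow_grow hL hh hhJ hσ hn hn' h1
  · exact improves_of_shrink_shrink hL hh hhJ hσ hn hn' c1.le h1

/-- Without corners a side continues forever, hence around the torus, against `exists_not_isTop`. -/
lemma not_isTop_of_not_improves (hL : 2 ≤ L) (hh : 0 < h) (hhJ : h < J)
    (hJh : ∀ k : ℤ, J / (2 * h) - 1 / 2 ≠ k) {σ : Config L}
    (hσ : ¬ Improves J h σ) (a b : ZMod L) : ¬ IsTop σ a b := by
  have htr : ∀ v : ZMod L × ZMod L, ∀ a b, IsTop (σ ∘ translation v) a b ↔ IsTop σ (a + v.1) (b + v.2) := by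
    rintro ⟨p, q⟩ a b
    simp only [IsTop, Function.comp_apply, translation_inl, translation_inr, Prod.mk_add_mk,
      sub_add_eq_add_sub]
  have step : ∀ a b, IsTop σ a b → IsTop σ (a + 1) b := by
    intro a b H
    have hσ' : ¬ Improves J h (σ ∘ translation (a + 1, b)) := fun h => hσ h.of_comp
    have := isTop_succ_of_not_improves hL hh hhJ hJh hσ' (by rw [htr]; simpa using H)
    rw [htr] at this
    simpa using this
  intro H
  have all : ∀ k : ℕ, IsTop σ (a + k) b := by
    intro k
    induction k with
    | zero => simpa using H
    | succ k ih =>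
      have := step _ _ ih
      rwa [add_assoc, ← Nat.cast_succ] at this
  obtain ⟨a', ha'⟩ := exists_not_isTop hL hh hhJ hσ b
  refine ha' ?_
  have := all (a' - a).val
  rwa [ZMod.natCast_val, ZMod.cast_id, add_sub_cancel] at this

/-- Every configuration other than the two constant ones can be improved. -/
theorem improves_of_ne (hL : 2 ≤ L) (hh : 0 < h) (hhJ : h < J)
    (hJh : ∀ k : ℤ, J / (2 * h) - 1 / 2 ≠ k) {σ : Config L}
    (h1 : σ ≠ allMinus L) (h2 : σ ≠ allPlus L) : Improves J h σ := by
  by_contra hσ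
  -- going once around a vertex no spin can drop from plus to minus
  have hN : ∀ τ : Config L, ¬ Improves J h τ → τ (.inr (0, -1)) = 1 → τ (.inl (0, 0)) = 1 := by
    intro τ hτ h3
    by_contra h4
    exact not_isTop_of_not_improves hL hh hhJ hJh hτ 0 0
      ⟨by simpa using h3, eq_neg_one_of_ne_one h4⟩
  have hR : ∀ τ : Config L, ¬ Improves J h τ → ¬ Improves J h (τ ∘ rotation) :=
    fun τ hτ H => hτ H.of_comp
  have hv : ∀ a b, (σ (.inr (a, b - 1)) = 1 → σ (.inl (a, b)) = 1) ∧
      (σ (.inl (a, b)) = 1 → σ (.inr (a - 1, b)) = 1) ∧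
      (σ (.inr (a - 1, b)) = 1 → σ (.inl (a - 1, b)) = 1) ∧
      (σ (.inl (a - 1, b)) = 1 → σ (.inr (a - 1, b - 1)) = 1) ∧
      (σ (.inr (a - 1, b - 1)) = 1 → σ (.inl (a, b - 1)) = 1) ∧
      (σ (.inl (a, b - 1)) = 1 → σ (.inr (a, b - 1)) = 1) := by
    intro a b
    have t0 : ¬ Improves J h (σ ∘ translation (a, b)) := fun h => hσ h.of_comp
    have t1 := hR _ t0
    have t2 := hR _ t1
    have t3 := hR _ t2
    have t4 := hR _ t3
    have t5 := hR _ t4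
    have k0 := hN _ t0
    have k1 := hN _ t1
    have k2 := hN _ t2
    have k3 := hN _ t3
    have k4 := hN _ t4
    have k5 := hN _ t5
    simp [translation_inl, translation_inr, rotation_inl, rotation_inr, neg_add_eq_sub] at k0 k1 k2 k3 k4 k5
    exact ⟨k0, k1, k2, k3, k4, k5⟩
  -- Plus spins spread to the left and downwards around vertices; by periodicity these two
  -- directions reach every cell.
  have hU : ∀ a b, σ (.inl (a, b)) = 1 → ∀ c d, σ (.inl (c, d)) = 1 := by
    intro a b H
    have g1 : ∀ i : ℕ, σ (.inl (a - i, b)) = 1 := by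
      intro i
      induction i with
      | zero => simpa using H
      | succ i ih =>
        obtain ⟨-, k1, k2, -⟩ := hv (a - i) b
        rw [Nat.cast_succ, ← sub_sub]
        exact k2 (k1 ih)
    have g2 : ∀ i j : ℕ, σ (.inl (a - i, b - j)) = 1 := by
      intro i j
      induction j with
      | zero => simpa using g1 i
      | succ j ih =>
        obtain ⟨-, k1, k2, k3, k4, -⟩ := hv (a - i) (b - j)
        rw [Nat.cast_succ, ← sub_sub]
        exact k4 (k3 (k2 (k1 ih)))
    intro c d
    have := g2 (a - c).val (b - d).val
    rwa [ZMod.natCast_val, ZMod.cast_id, ZMod.natCast_val, ZMod.cast_id, sub_sub_cancel,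
      sub_sub_cancel] at this
  by_cases hx : ∃ a b, σ (.inl (a, b)) = 1
  · obtain ⟨a, b, hab⟩ := hx
    refine h2 (funext ?_)
    rintro (⟨c, d⟩ | ⟨c, d⟩)
    · exact hU a b hab c d
    · have := (hv (c + 1) d).2.1 (hU a b hab _ _)
      rwa [add_sub_cancel_right] at this
  · push Not at hx
    refine h1 (funext ?_)
    rintro (⟨c, d⟩ | ⟨c, d⟩)
    · exact eq_neg_one_of_ne_one (hx c d)
    · refine eq_neg_one_of_ne_one fun h3 => hx c (d + 1) ((hv c (d + 1)).1 ?_)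
      rwa [add_sub_cancel_right]

end Constant

/-! ### Survival probabilities of a finite Markov chain -/

section Survival

variable {X : Type*} [Fintype X]

/-- The probability that the chain with transition matrix `P` started from `x` avoids `B` at the
times `0, …, n`. -/
noncomputable def survival (P : X → X → ℝ) (B : Set X) : ℕ → X → ℝ
  | 0 => Bᶜ.indicator 1
  | n + 1 => Bᶜ.indicator fun x => ∑ y, P x y * survival P B n y

variable {P : X → X → ℝ} {B : Set X}

lemma survival_of_mem (n : ℕ) {x : X} (hx : x ∈ B) : survival P B n x = 0 := by
  cases n <;> simp [survival, hx]

lemma survival_zero {x : X} (hx : x ∉ B) : survival P B 0 x = 1 := by simp [survival, hx]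

lemma survival_succ (n : ℕ) {x : X} (hx : x ∉ B) :
    survival P B (n + 1) x = ∑ y, P x y * survival P B n y := by simp [survival, hx]

variable (hP : ∀ x y, 0 ≤ P x y) (hP1 : ∀ x, ∑ y, P x y = 1)
include hP

lemma survival_nonneg (n : ℕ) (x : X) : 0 ≤ survival P B n x := by
  induction n generalizing x with
  | zero => exact Set.indicator_nonneg (fun _ _ => zero_le_one) x
  | succ n ih =>
    exact Set.indicator_nonneg (fun x _ => Finset.sum_nonneg fun y _ => mul_nonneg (hP x y) (ih y)) x

/-- Linear inequalities between survival probabilities propagate in time. -/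
lemma survival_shift {a b c : ℝ} {i j k : ℕ}
    (H : ∀ x, 0 ≤ a * survival P B i x + b * survival P B j x + c * survival P B k x) (n : ℕ) (x : X) :
    0 ≤ a * survival P B (n + i) x + b * survival P B (n + j) x + c * survival P B (n + k) x := by
  induction n generalizing x with
  | zero => simpa using H x
  | succ n ih =>
    by_cases hx : x ∈ B
    · simp [survival_of_mem _ hx]
    · rw [Nat.add_right_comm n 1 i, Nat.add_right_comm n 1 j, Nat.add_right_comm n 1 k, survival_succ _ hx, survival_succ _ hx, survival_succ _ hx,
        Finset.mul_sum, Finset.mul_sum, Finset.mul_sum, ← Finset.sum_add_distrib,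
        ← Finset.sum_add_distrib]
      refine Finset.sum_nonneg fun y _ => ?_
      have := mul_nonneg (hP x y) (ih y)
      linarith

include hP1

lemma survival_le_one (n : ℕ) (x : X) : survival P B n x ≤ 1 := by
  induction n generalizing x with
  | zero => exact Set.indicator_apply_le' (fun _ => le_rfl) fun _ => zero_le_one
  | succ n ih =>
    refine Set.indicator_apply_le' (fun _ => ?_) fun _ => zero_le_one
    calc ∑ y, P x y * survival P B n y ≤ ∑ y, P x y :=
          Finset.sum_le_sum fun y _ => mul_le_of_le_one_right (hP x y) (ih y)
      _ = 1 := hP1 x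

lemma survival_le_survival_zero (n : ℕ) (x : X) : survival P B n x ≤ survival P B 0 x := by
  by_cases hx : x ∈ B
  · rw [survival_of_mem _ hx, survival_of_mem _ hx]
  · rw [survival_zero hx]; exact survival_le_one hP hP1 n x

lemma survival_succ_le (n : ℕ) (x : X) : survival P B (n + 1) x ≤ survival P B n x := by
  have := survival_shift (B := B) hP (a := 1) (b := -1) (c := 0) (i := 0) (j := 1) (k := 0)
    (fun x => by linarith [survival_le_survival_zero (B := B) hP hP1 1 x]) n x
  simp at this
  linarith

lemma survival_antitone (x : X) : Antitone fun n => survival P B n x :=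
  antitone_nat_of_succ_le fun n => survival_succ_le hP hP1 n x

/-- Keeping only the trajectories that do not move in the first step, each additional unit of time
loses at most `p`. -/
lemma one_sub_survival_le {x : X} (hx : x ∉ B) {p : ℝ} (hp : 1 - P x x ≤ p) (n : ℕ) :
    1 - survival P B n x ≤ n * p := by
  induction n with
  | zero => simp [survival_zero hx]
  | succ n ih =>
    have h1 : P x x * survival P B n x ≤ survival P B (n + 1) x := by
      rw [survival_succ n hx]
      exact Finset.single_le_sum (f := fun y => P x y * survival P B n y)
        (fun y _ => mul_nonneg (hP x y) (survival_nonneg hP n y)) (Finset.mem_univ x)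
    have h2 := survival_le_one (B := B) hP hP1 n x
    have h3 := survival_nonneg (B := B) hP n x
    have h4 : P x x ≤ 1 := by
      rw [← hP1 x]
      exact Finset.single_le_sum (fun y _ => hP x y) (Finset.mem_univ x)
    push_cast
    nlinarith [mul_nonneg (sub_nonneg.2 h4) (sub_nonneg.2 h2)]

end Survival

/-! ### Exponential decay from a Poincaré inequality -/

section Reversible

variable {X : Type*} [Fintype X] {P : X → X → ℝ} {B : Set X} {μ : X → ℝ}
  (hrev : ∀ x y, μ x * P x y = μ y * P y x)
include hrev

/-- The transition operator killed on `B` is self-adjoint in $\ell^2(\mu)$, and survival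
probabilities are its powers applied to the indicator of the complement of `B`. -/
lemma sum_mul_survival_mul_survival (n k : ℕ) :
    ∑ x, μ x * (survival P B n x * survival P B k x) = ∑ x, μ x * survival P B (n + k) x := by
  induction n generalizing k with
  | zero =>
    refine Finset.sum_congr rfl fun x _ => ?_
    by_cases hx : x ∈ B
    · simp [survival_of_mem _ hx]
    · simp [survival_zero hx]
  | succ n ih =>
    rw [Nat.succ_add_eq_add_succ, ← ih (k + 1)]
    have e : ∀ i j x, μ x * (survival P B (i + 1) x * survival P B j x)
        = ∑ y, μ x * P x y * (survival P B i y * survival P B j x) := by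
      intro i j x
      by_cases hx : x ∈ B
      · simp [survival_of_mem _ hx]
      · rw [survival_succ _ hx, Finset.sum_mul, Finset.mul_sum]
        exact Finset.sum_congr rfl fun y _ => by ring
    have e' : ∀ x, μ x * (survival P B n x * survival P B (k + 1) x)
        = ∑ y, μ x * P x y * (survival P B k y * survival P B n x) := by
      intro x; rw [← e, mul_comm (survival P B n x)]
    simp only [e, e']
    rw [Finset.sum_comm]
    refine Finset.sum_congr rfl fun y _ => Finset.sum_congr rfl fun x _ => ?_
    rw [hrev]; ring

lemma dirichlet_survival (hP1 : ∀ x, ∑ y, P x y = 1) (n : ℕ) :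
    ∑ x, ∑ y, μ x * P x y * (survival P B n x - survival P B n y) ^ 2
      = 2 * (∑ x, μ x * survival P B (n + n) x - ∑ x, μ x * survival P B (n + n + 1) x) := by
  set u := survival P B n
  have h1 : ∑ x, ∑ y, μ x * P x y * u x ^ 2 = ∑ x, μ x * survival P B (n + n) x := by
    rw [← sum_mul_survival_mul_survival hrev]
    refine Finset.sum_congr rfl fun x _ => ?_
    rw [← Finset.sum_mul, ← Finset.mul_sum, hP1]; ring
  have h2 : ∑ x, ∑ y, μ x * P x y * u y ^ 2 = ∑ x, μ x * survival P B (n + n) x := by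
    rw [← h1, Finset.sum_comm]
    exact Finset.sum_congr rfl fun x _ => Finset.sum_congr rfl fun y _ => by rw [hrev]
  have h3 : ∑ x, ∑ y, μ x * P x y * (u x * u y) = ∑ x, μ x * survival P B (n + n + 1) x := by
    rw [add_assoc, ← sum_mul_survival_mul_survival hrev]
    refine Finset.sum_congr rfl fun x _ => ?_
    by_cases hx : x ∈ B
    · simp [u, survival_of_mem _ hx]
    · rw [survival_succ _ hx, Finset.mul_sum, Finset.mul_sum]
      exact Finset.sum_congr rfl fun y _ => by ring
  calc _ = ∑ x, ∑ y, (μ x * P x y * u x ^ 2 + μ x * P x y * u y ^ 2 - 2 * (μ x * P x y * (u x * u y))) :=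
        Finset.sum_congr rfl fun x _ => Finset.sum_congr rfl fun y _ => by ring
    _ = _ := by
        simp only [Finset.sum_sub_distrib, Finset.sum_add_distrib, ← Finset.mul_sum]
        rw [h1, h2, h3]; ring

/-- A Poincaré inequality for functions vanishing on `B` gives exponential decay of the survival
probabilities. -/
lemma survival_le_exp (hP : ∀ x y, 0 ≤ P x y) (hP1 : ∀ x, ∑ y, P x y = 1) (hμ : ∀ x, 0 < μ x)
    {C : ℝ} (hC : 0 < C)
    (hpoinc : ∀ f : X → ℝ, (∀ x ∈ B, f x = 0) →
      ∑ x, μ x * f x ^ 2 ≤ C * ∑ x, ∑ y, μ x * P x y * (f x - f y) ^ 2) (n : ℕ) (x : X) :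
    survival P B (2 * n) x ≤ (∑ y, μ y) / μ x * Real.exp (-(n / (2 * C))) := by
  set a : ℕ → ℝ := fun n => ∑ x, μ x * survival P B n x with ha
  have hmono : ∀ n, a (n + 1) ≤ a n := fun n =>
    Finset.sum_le_sum fun x _ => mul_le_mul_of_nonneg_left (survival_succ_le hP hP1 n x) (hμ x).le
  have hnonneg : ∀ n, 0 ≤ a n := fun n =>
    Finset.sum_nonneg fun x _ => mul_nonneg (hμ x).le (survival_nonneg hP n x)
  -- The Dirichlet form of the survival function at time `n` is the drop of `a` from $2n$ to $2n+1$.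
  -- The decay is extracted only there; the next step uses monotonicity, so negative eigenvalues
  -- play no role.
  have hstep : ∀ n, a (n + n + 1) ≤ Real.exp (-(1 / (2 * C))) * a (n + n) := by
    intro n
    have h1 := hpoinc (survival P B n) fun x hx => survival_of_mem n hx
    rw [dirichlet_survival hrev hP1] at h1
    have h2 : ∑ x, μ x * survival P B n x ^ 2 = a (n + n) := by
      rw [ha]
      simp only
      rw [← sum_mul_survival_mul_survival hrev]
      exact Finset.sum_congr rfl fun x _ => by ring
    rw [h2] at h1
    have h3 : a (n + n + 1) ≤ (1 - 1 / (2 * C)) * a (n + n) := by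
      have h4 : a (n + n) / (2 * C) ≤ a (n + n) - a (n + n + 1) := by
        rw [div_le_iff₀ (by positivity)]
        linarith
      have e : (1 - 1 / (2 * C)) * a (n + n) = a (n + n) - a (n + n) / (2 * C) := by ring
      linarith
    refine h3.trans (mul_le_mul_of_nonneg_right ?_ (hnonneg _))
    have := Real.add_one_le_exp (-(1 / (2 * C)))
    linarith
  have hdecay : ∀ n : ℕ, a (n + n) ≤ Real.exp (-(n / (2 * C))) * a 0 := by
    intro n
    induction n with
    | zero => simp
    | succ n ih =>
      have e : Real.exp (-((n + 1 : ℕ) / (2 * C))) = Real.exp (-(1 / (2 * C))) * Real.exp (-(n / (2 * C))) := by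
        rw [← Real.exp_add]; congr 1; push_cast; ring
      rw [show n + 1 + (n + 1) = n + n + 1 + 1 by ring, e, mul_assoc]
      refine (hmono _).trans ((hstep n).trans ?_)
      exact mul_le_mul_of_nonneg_left ih (Real.exp_pos _).le
  have ha0 : a 0 ≤ ∑ y, μ y :=
    Finset.sum_le_sum fun x _ => mul_le_of_le_one_right (hμ x).le (survival_le_one hP hP1 0 x)
  have hx : μ x * survival P B (2 * n) x ≤ a (n + n) := by
    rw [two_mul]
    exact Finset.single_le_sum (f := fun x => μ x * survival P B (n + n) x)
      (fun y _ => mul_nonneg (hμ y).le (survival_nonneg hP _ y)) (Finset.mem_univ x)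
  rw [div_mul_eq_mul_div, le_div_iff₀ (hμ x), mul_comm]
  refine hx.trans ((hdecay n).trans ?_)
  rw [mul_comm (∑ y, μ y)]
  exact mul_le_mul_of_nonneg_left ha0 (Real.exp_pos _).le

end Reversible

/-! ### Approximate renewal at the metastable state -/

section Factorization

variable {X : Type*} [Fintype X] {P : X → X → ℝ} (hP : ∀ x y, 0 ≤ P x y)
  (hP1 : ∀ x, ∑ y, P x y = 1) {m s : X} (hms : m ≠ s)
include hP hP1 hms

/-- Either `{m, s}` is avoided up to time `r`, or `m` is visited by then and at least `k` further
steps must be survived from there. -/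
lemma survival_le_add (r k : ℕ) (x : X) :
    survival P {s} (r + k) x ≤ survival P {m, s} r x + survival P {s} k m := by
  induction r generalizing x with
  | zero =>
    rw [zero_add]
    by_cases hs : x = s
    · rw [survival_of_mem _ (by simp [hs])]
      exact add_nonneg (survival_nonneg hP _ _) (survival_nonneg hP _ _)
    by_cases hm : x = m
    · subst hm
      linarith [survival_nonneg (B := {x, s}) hP 0 x]
    · rw [survival_zero (B := {m, s}) (by simp [hs, hm])]
      linarith [survival_le_one (B := {s}) hP hP1 k x, survival_nonneg (B := {s}) hP k m]
  | succ r ih =>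
    by_cases hs : x = s
    · rw [survival_of_mem _ (by simp [hs])]
      exact add_nonneg (survival_nonneg hP _ _) (survival_nonneg hP _ _)
    by_cases hm : x = m
    · subst hm
      have := survival_antitone (B := {s}) hP hP1 x (by lia : k ≤ r + 1 + k)
      linarith [survival_nonneg (B := {x, s}) hP (r + 1) x]
    · rw [show r + 1 + k = r + k + 1 by ring, survival_succ (B := {s}) _ (by simp [hs]),
        survival_succ (B := {m, s}) _ (by simp [hs, hm])]
      calc ∑ y, P x y * survival P {s} (r + k) y
          ≤ ∑ y, P x y * (survival P {m, s} r y + survival P {s} k m) :=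
            Finset.sum_le_sum fun y _ => mul_le_mul_of_nonneg_left (ih y) (hP x y)
        _ = _ := by
            simp only [mul_add, Finset.sum_add_distrib]
            rw [← Finset.sum_mul, hP1, one_mul]

/-- The difference is the probability of visiting `m` by time `r` while avoiding `s`. Surviving `k`
steps after that visit is enough to survive to time `k`. -/
lemma mul_survival_le (r k : ℕ) (x : X) :
    (survival P {s} r x - survival P {m, s} r x) * survival P {s} k m ≤ survival P {s} k x := by
  have hk0 := fun k => survival_nonneg (B := {s}) hP k m
  have hcase : ∀ r k x, x = s ∨ x = m →
      (survival P {s} r x - survival P {m, s} r x) * survival P {s} k m ≤ survival P {s} k x := by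
    rintro r k x (rfl | rfl)
    · simp [survival_of_mem]
    · rw [survival_of_mem (B := {x, s}) _ (by simp)]
      have := survival_le_one (B := {s}) hP hP1 r x
      nlinarith [hk0 k]
  induction r generalizing x k with
  | zero =>
    by_cases hx : x = s ∨ x = m
    · exact hcase _ _ _ hx
    · push Not at hx
      rw [survival_zero (by simp [hx]), survival_zero (by simp [hx])]
      simpa using survival_nonneg hP k x
  | succ r ih =>
    by_cases hx : x = s ∨ x = m
    · exact hcase _ _ _ hx
    · push Not at hx
      -- The sign is needed to replace $s(k+1)$ by $s(k)$ in the product before conditioning on the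
      -- first step.
      by_cases hneg : survival P {s} (r + 1) x - survival P {m, s} (r + 1) x ≤ 0
      · exact (mul_nonpos_of_nonpos_of_nonneg hneg (hk0 k)).trans (survival_nonneg hP k x)
      push Not at hneg
      rcases k with _ | k
      · rw [survival_zero (B := {s}) (x := x) (by simp [hx])]
        have h1 := survival_le_one (B := {s}) hP hP1 (r + 1) x
        have h2 := survival_nonneg (B := {m, s}) hP (r + 1) x
        have h3 := survival_le_one (B := {s}) hP hP1 0 m
        nlinarith [hk0 0]
      · calc _ ≤ (survival P {s} (r + 1) x - survival P {m, s} (r + 1) x) * survival P {s} k m :=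
              mul_le_mul_of_nonneg_left (survival_succ_le hP hP1 k m) hneg.le
          _ = ∑ y, P x y * ((survival P {s} r y - survival P {m, s} r y) * survival P {s} k m) := by
              rw [survival_succ (B := {s}) _ (by simp [hx]), survival_succ (B := {m, s}) _ (by simp [hx]),
                ← Finset.sum_sub_distrib, Finset.sum_mul]
              exact Finset.sum_congr rfl fun y _ => by ring
          _ ≤ ∑ y, P x y * survival P {s} k y :=
              Finset.sum_le_sum fun y _ => mul_le_mul_of_nonneg_left (ih k y) (hP x y)
          _ = _ := (survival_succ k (by simp [hx])).symm

variable {R : ℕ} {ε : ℝ} (hε : ∀ x, survival P {m, s} R x ≤ ε)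
include hε

omit hP hP1 hms in
lemma survival_pair_le (x : X) : survival P {m, s} R x ≤ ε * survival P {s} 0 x := by
  by_cases hs : x = s
  · rw [survival_of_mem _ (by simp [hs]), survival_of_mem _ (by simp [hs]), mul_zero]
  · rw [survival_zero (B := {s}) (by simp [hs]), mul_one]; exact hε x

/-- `survival_le_add` is applied to the position of the chain at time `n`; `survival_shift`
integrates it over the law at that time. -/
lemma survival_add_le_mul (n k : ℕ) :
    survival P {s} (n + (R + k)) m ≤ survival P {s} n m * (ε + survival P {s} k m) := by
  have := survival_shift (B := {s}) hP (a := ε + survival P {s} k m) (b := -1) (c := 0) (i := 0)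
    (j := R + k) (k := 0) (fun x => ?_) n m
  · simp at this; linarith
  · have h1 := survival_le_add hP hP1 hms R k x
    have h2 := survival_pair_le hε x
    by_cases hs : x = s
    · simp [survival_of_mem (B := {s}) (x := x) _ (by simp [hs])]
    · rw [survival_zero (B := {s}) (by simp [hs])] at h2 ⊢
      linarith

lemma mul_le_survival_add (n k : ℕ) :
    survival P {s} k m * (survival P {s} (n + R) m - ε * survival P {s} n m)
      ≤ survival P {s} (n + k) m := by
  have := survival_shift (B := {s}) hP (a := 1) (b := -survival P {s} k m)
    (c := ε * survival P {s} k m) (i := k) (j := R) (k := 0) (fun x => ?_) n m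
  · simp at this; linarith
  · have h1 := mul_survival_le hP hP1 hms R k x
    have h2 := survival_pair_le hε x
    have h3 := survival_nonneg (B := {s}) hP k m
    nlinarith

/-- For `n ≥ R`, with start at time `n - R`: up to probability `ε` a trajectory surviving until `n`
has visited `m` since, and from `m` it rarely reaches `s` within `2 R`. For `n < R` the whole window
lies before `2 R`. -/
lemma survival_sub_le (n : ℕ) :
    survival P {s} n m - survival P {s} (n + R) m ≤ ε + (1 - survival P {s} (R + R) m) := by
  have hε0 : 0 ≤ ε := (survival_nonneg hP R m).trans (hε m)
  have h2R := survival_le_one (B := {s}) hP hP1 (R + R) m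
  rcases le_or_gt R n with hn | hn
  · obtain ⟨n, rfl⟩ := Nat.exists_eq_add_of_le hn
    have := survival_shift (B := {s}) hP (a := ε + (1 - survival P {s} (R + R) m)) (b := -1) (c := 1)
      (i := 0) (j := R) (k := R + R) (fun x => ?_) n m
    · have h1 := survival_le_one (B := {s}) hP hP1 n m
      have e1 : R + n = n + R := add_comm _ _
      rw [e1, add_assoc]
      have : (ε + (1 - survival P {s} (R + R) m)) * survival P {s} (n + 0) m
          ≤ ε + (1 - survival P {s} (R + R) m) := mul_le_of_le_one_right (by linarith) h1
      linarith
    · have h1 := mul_survival_le hP hP1 hms R (R + R) x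
      have h2 := survival_pair_le hε x
      have h3 := survival_le_survival_zero (B := {s}) hP hP1 R x
      have h4 := survival_nonneg (B := {s}) hP (R + R) m
      have h5 := survival_nonneg (B := {m, s}) hP R x
      nlinarith
  · have h1 := survival_le_one (B := {s}) hP hP1 n m
    have h2 := survival_antitone (B := {s}) hP hP1 m (by lia : n + R ≤ R + R)
    simp only at h2
    linarith

end Factorization

/-! ### From almost multiplicative tails to the exponential law and its mean -/

section ExponentialLimit

variable {ι : Type*} {l : Filter ι} {s : ι → ℕ → ℝ} {T : ι → ℕ} {δ : ι → ℝ}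

lemma abs_floor_add_sub_le {s : ℕ → ℝ} {T : ℕ} {δ : ℝ} (hanti : Antitone s)
    (hmul : ∀ n k, |s (n + k) - s n * s k| ≤ δ) (hjump : ∀ n, s n - s (n + 1) ≤ δ)
    {t r : ℝ} (ht : 0 ≤ t) (hr : 0 ≤ r) :
    |s ⌊(t + r) * T⌋₊ - s ⌊t * T⌋₊ * s ⌊r * T⌋₊| ≤ 2 * δ := by
  have h1 := hmul ⌊t * T⌋₊ ⌊r * T⌋₊
  have hT : (0 : ℝ) ≤ T := Nat.cast_nonneg T
  have ht' : 0 ≤ t * T := mul_nonneg ht hT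
  have hr' : 0 ≤ r * T := mul_nonneg hr hT
  have h2 : ⌊t * T⌋₊ + ⌊r * T⌋₊ ≤ ⌊(t + r) * T⌋₊ := by
    refine Nat.le_floor ?_
    push_cast
    linarith [Nat.floor_le ht', Nat.floor_le hr']
  have h3 : ⌊(t + r) * T⌋₊ ≤ ⌊t * T⌋₊ + ⌊r * T⌋₊ + 1 := by
    refine Nat.lt_succ_iff.1 ((Nat.floor_lt (by positivity)).2 ?_)
    push_cast
    linarith [Nat.lt_floor_add_one (t * T), Nat.lt_floor_add_one (r * T)]
  have h4 := hanti h2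
  have h5 := hanti h3
  have h6 := hjump (⌊t * T⌋₊ + ⌊r * T⌋₊)
  rw [abs_le] at h1 ⊢
  constructor <;> linarith

/-- Approximate multiplicativity determines the limit at $1/q$ as a $q$-th root of $e^{-1}$, its
powers give all rational times, and monotonicity with continuity of $e^{-t}$ gives the real ones.
Rounding $tT$ costs at most one jump, bounded by `δ`. -/
lemma tendsto_floor_exp (hδ : Tendsto δ l (𝓝 0)) (hs0 : ∀ i, s i 0 = 1)
    (hanti : ∀ i, Antitone (s i)) (hnonneg : ∀ i n, 0 ≤ s i n)
    (hmul : ∀ᶠ i in l, ∀ n k, |s i (n + k) - s i n * s i k| ≤ δ i)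
    (hjump : ∀ᶠ i in l, ∀ n, s i n - s i (n + 1) ≤ δ i)
    (hT : Tendsto (fun i => s i (T i)) l (𝓝 (Real.exp (-1)))) (t : ℝ) (ht : 0 ≤ t) :
    Tendsto (fun i => s i ⌊t * T i⌋₊) l (𝓝 (Real.exp (-t))) := by
  have hle : ∀ i n, s i n ≤ 1 := fun i n => hs0 i ▸ hanti i (Nat.zero_le n)
  have hadd : ∀ t r : ℝ, 0 ≤ t → 0 ≤ r → Tendsto (fun i => s i ⌊(t + r) * T i⌋₊
      - s i ⌊t * T i⌋₊ * s i ⌊r * T i⌋₊) l (𝓝 0) := by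
    intro t r ht hr
    refine squeeze_zero_norm' ?_ (by simpa using hδ.const_mul 2)
    filter_upwards [hmul, hjump] with i h1 h2
    exact abs_floor_add_sub_le (hanti i) h1 h2 ht hr
  have hpow : ∀ t : ℝ, 0 ≤ t → ∀ k : ℕ,
      Tendsto (fun i => s i ⌊(k * t) * T i⌋₊ - s i ⌊t * T i⌋₊ ^ k) l (𝓝 0) := by
    intro t ht k
    induction k with
    | zero => simp [hs0, tendsto_const_nhds]
    | succ k ih =>
      have h1 := hadd (k * t) t (by positivity) ht
      have h2 : Tendsto (fun i => (s i ⌊(k * t) * T i⌋₊ - s i ⌊t * T i⌋₊ ^ k) * s i ⌊t * T i⌋₊) l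
          (𝓝 0) := by
        refine ih.zero_mul_isBoundedUnder_le ?_
        refine isBoundedUnder_of ⟨1, fun i => ?_⟩
        rw [Function.comp_apply, Real.norm_of_nonneg (hnonneg _ _)]
        exact hle _ _
      have h3 := h1.add h2
      rw [add_zero] at h3
      refine h3.congr fun i => ?_
      rw [pow_succ]
      push_cast
      rw [add_one_mul (k : ℝ) t]
      ring
  have hinv : ∀ q : ℕ, q ≠ 0 →
      Tendsto (fun i => s i ⌊(q : ℝ)⁻¹ * T i⌋₊) l (𝓝 (Real.exp (-(q : ℝ)⁻¹))) := by
    intro q hq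
    have hq' : (q : ℝ) ≠ 0 := Nat.cast_ne_zero.2 hq
    have h1 := hpow (q : ℝ)⁻¹ (by positivity) q
    rw [mul_inv_cancel₀ hq'] at h1
    have h2 : Tendsto (fun i => s i ⌊(q : ℝ)⁻¹ * T i⌋₊ ^ q) l (𝓝 (Real.exp (-1))) := by
      have := hT.sub h1
      rw [sub_zero] at this
      refine this.congr fun i => ?_
      simp
    have h3 := h2.rpow_const (p := (q : ℝ)⁻¹) (Or.inl (Real.exp_pos _).ne')
    rw [← Real.exp_mul, neg_one_mul] at h3
    exact h3.congr fun i => Real.pow_rpow_inv_natCast (hnonneg _ _) hq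
  have hrat : ∀ r : ℚ, 0 ≤ r → Tendsto (fun i => s i ⌊(r : ℝ) * T i⌋₊) l (𝓝 (Real.exp (-r))) := by
    intro r hr
    have h1 := hpow (r.den : ℝ)⁻¹ (by positivity) r.num.toNat
    have h2 := (hinv r.den r.den_ne_zero).pow r.num.toNat
    have e : (r.num.toNat : ℝ) * (r.den : ℝ)⁻¹ = r := by
      have h3 : ((r.num.toNat : ℤ) : ℝ) = (r.num : ℝ) := by
        rw [Int.toNat_of_nonneg (Rat.num_nonneg.2 hr)]
      rw [← Int.cast_natCast (R := ℝ), h3, ← div_eq_mul_inv, ← Rat.cast_def]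
    have h3 := h1.add h2
    rw [zero_add, ← Real.exp_nat_mul, mul_neg, e] at h3
    exact h3.congr fun i => by ring
  have hmono : ∀ i, ∀ {a b : ℝ}, a ≤ b → s i ⌊b * T i⌋₊ ≤ s i ⌊a * T i⌋₊ := fun i a b hab =>
    hanti i (Nat.floor_le_floor (mul_le_mul_of_nonneg_right hab (Nat.cast_nonneg _)))
  have hcont : Continuous fun x : ℝ => Real.exp (-x) := by fun_prop
  rcases ht.eq_or_lt with rfl | ht0
  · simp [hs0, tendsto_const_nhds]
  refine tendsto_order.2 ⟨fun a ha => ?_, fun a ha => ?_⟩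
  · obtain ⟨u, v, ⟨hu, hv⟩, huv⟩ := mem_nhds_iff_exists_Ioo_subset.1
      (hcont.continuousAt.eventually (lt_mem_nhds ha))
    obtain ⟨r, hr1, hr2⟩ := exists_rat_btwn hv
    have har : a < Real.exp (-r) := huv ⟨hu.trans hr1, hr2⟩
    filter_upwards [(hrat r (by exact_mod_cast ht.trans hr1.le)).eventually (lt_mem_nhds har)]
      with i hi
    exact hi.trans_le (hmono i hr1.le)
  · obtain ⟨u, v, ⟨hu, hv⟩, huv⟩ := mem_nhds_iff_exists_Ioo_subset.1
      (hcont.continuousAt.eventually (gt_mem_nhds ha))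
    obtain ⟨r, hr1, hr2⟩ := exists_rat_btwn (max_lt hu ht0)
    have har : Real.exp (-r) < a := huv ⟨(le_max_left _ _).trans_lt hr1, hr2.trans hv⟩
    filter_upwards [(hrat r (by exact_mod_cast ((le_max_right u 0).trans_lt hr1).le)).eventually
      (gt_mem_nhds har)] with i hi
    exact (hmono i hr2.le).trans_lt hi

lemma tsum_ofReal_div_eq_lintegral (s : ℕ → ℝ) {T : ℕ} (hT : 1 ≤ T) :
    (∑' n, ENNReal.ofReal (s n)) / (T : ℝ≥0∞)
      = ∫⁻ x in Set.Ioi (0 : ℝ), ENNReal.ofReal (s ⌊x * T⌋₊) := by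
  have hT0 : (0 : ℝ) < T := by exact_mod_cast hT
  have hU : Set.Ici (0 : ℝ) = ⋃ n : ℕ, Set.Ico ((n : ℝ) / T) ((n + 1) / T) := by
    ext x
    simp only [Set.mem_Ici, Set.mem_iUnion, Set.mem_Ico]
    constructor
    · intro hx
      refine ⟨⌊x * T⌋₊, ?_, ?_⟩
      · rw [div_le_iff₀ hT0]; exact Nat.floor_le (by positivity)
      · rw [lt_div_iff₀ hT0]; exact Nat.lt_floor_add_one _
    · rintro ⟨n, hn, -⟩
      exact le_trans (by positivity) hn
  have hfl : ∀ n : ℕ, ∀ x ∈ Set.Ico ((n : ℝ) / T) ((n + 1) / T), ⌊x * T⌋₊ = n := by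
    rintro n x ⟨h1, h2⟩
    rw [div_le_iff₀ hT0] at h1
    rw [lt_div_iff₀ hT0] at h2
    exact (Nat.floor_eq_iff (le_trans (by positivity) h1)).2 ⟨h1, h2⟩
  rw [← setLIntegral_congr Ioi_ae_eq_Ici.symm, hU, lintegral_iUnion (fun n => measurableSet_Ico)]
  · rw [div_eq_mul_inv, ← ENNReal.tsum_mul_right]
    refine tsum_congr fun n => ?_
    rw [setLIntegral_congr_fun (g := fun _ => ENNReal.ofReal (s n)) measurableSet_Ico
      (fun x hx => by simp only [hfl n x hx]), setLIntegral_const, Real.volume_Ico]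
    congr 1
    rw [← sub_div, add_sub_cancel_left, one_div, ENNReal.ofReal_inv_of_pos hT0, ENNReal.ofReal_natCast]
  · intro n k hnk
    refine Set.disjoint_left.2 fun x hx hx' => hnk ?_
    rw [← hfl n x hx, ← hfl k x hx']

lemma tendsto_tsum_div [l.IsCountablyGenerated] (hs0 : ∀ i, s i 0 = 1)
    (hanti : ∀ i, Antitone (s i)) (hT1 : ∀ᶠ i in l, 1 ≤ T i)
    (hhalf : ∀ᶠ i in l, ∀ n, s i (n + (T i + T i)) ≤ s i n * (1 / 2))
    (hexp : ∀ t : ℝ, 0 ≤ t → Tendsto (fun i => s i ⌊t * T i⌋₊) l (𝓝 (Real.exp (-t)))) :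
    Tendsto (fun i => (∑' n, ENNReal.ofReal (s i n)) / (T i : ℝ≥0∞)) l (𝓝 1) := by
  have h1 : (∫⁻ x in Set.Ioi (0 : ℝ), ENNReal.ofReal (Real.exp (-x))) = 1 := by
    rw [← ofReal_integral_eq_lintegral_ofReal (integrableOn_exp_neg_Ioi 0)
      (ae_of_all _ fun x => (Real.exp_pos _).le), integral_exp_neg_Ioi_zero, ENNReal.ofReal_one]
  rw [← h1]
  have hlog : 0 < Real.log 2 / 2 := by positivity
  have hint := exp_neg_integrableOn_Ioi 0 hlog
  have key : Tendsto (fun i => ∫⁻ x in Set.Ioi (0 : ℝ), ENNReal.ofReal (s i ⌊x * T i⌋₊)) l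
      (𝓝 (∫⁻ x in Set.Ioi (0 : ℝ), ENNReal.ofReal (Real.exp (-x)))) := by
    -- The dominating function is $2\cdot2^{-x/2}$: the tail halves over every stretch of $2T$, and
    -- the factor $2$ absorbs the rounding of $x/2$.
    refine tendsto_lintegral_filter_of_dominated_convergence
      (fun x => ENNReal.ofReal (2 * Real.exp (-(Real.log 2 / 2) * x))) ?_ ?_ ?_ ?_
    · refine Eventually.of_forall fun i => ?_
      have : Measurable fun x : ℝ => ⌊x * T i⌋₊ := Nat.measurable_floor.comp (measurable_id.mul_const _)
      exact (measurable_from_nat (f := fun n => ENNReal.ofReal (s i n))).comp this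
    · filter_upwards [hT1, hhalf] with i hT hi
      refine (ae_restrict_iff' measurableSet_Ioi).2 (ae_of_all _ fun x hx => ?_)
      refine ENNReal.ofReal_le_ofReal ?_
      have hx0 : (0 : ℝ) < x := hx
      have hpow : ∀ j : ℕ, s i (j * (T i + T i)) ≤ (1 / 2) ^ j := by
        intro j
        induction j with
        | zero => simp [hs0]
        | succ j ih =>
          rw [Nat.succ_mul, pow_succ]
          exact (hi _).trans (mul_le_mul_of_nonneg_right ih (by norm_num))
      have h2 : ⌊x / 2⌋₊ * (T i + T i) ≤ ⌊x * T i⌋₊ := by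
        refine Nat.le_floor ?_
        have := Nat.floor_le (by positivity : 0 ≤ x / 2)
        have hT0 : (0 : ℝ) ≤ T i := Nat.cast_nonneg _
        push_cast
        nlinarith
      refine (hanti i h2).trans ((hpow _).trans ?_)
      have e : ((1 : ℝ) / 2) ^ ⌊x / 2⌋₊ = Real.exp (-Real.log 2 * ⌊x / 2⌋₊) := by
        rw [mul_comm, Real.exp_nat_mul, Real.exp_neg, Real.exp_log (by norm_num)]; norm_num
      have e2 : 2 * Real.exp (-(Real.log 2 / 2) * x)
          = Real.exp (Real.log 2 + -(Real.log 2 / 2) * x) := by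
        rw [Real.exp_add, Real.exp_log (by norm_num)]
      rw [e, e2, Real.exp_le_exp]
      have := Nat.lt_floor_add_one (x / 2)
      have hl := Real.log_pos (by norm_num : (1 : ℝ) < 2)
      nlinarith
    · have h2 : IntegrableOn (fun x => 2 * Real.exp (-(Real.log 2 / 2) * x)) (Set.Ioi (0 : ℝ)) :=
        hint.const_mul 2
      rw [← ofReal_integral_eq_lintegral_ofReal h2 (ae_of_all _ fun x => by positivity)]
      exact ENNReal.ofReal_ne_top
    · refine (ae_restrict_iff' measurableSet_Ioi).2 (ae_of_all _ fun x hx => ?_)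
      exact (ENNReal.continuous_ofReal.tendsto _).comp (hexp x (le_of_lt hx))
  refine key.congr' ?_
  filter_upwards [hT1] with i hi
  exact (tsum_ofReal_div_eq_lintegral (s i) hi).symm

end ExponentialLimit

/-! ### Reaching the constant configurations -/

section Wells

variable {L : ℕ} [NeZero L] {J h : ℝ}

/-- From every configuration one of the two constant configurations can be reached at height at most
`2 J`. -/
theorem exists_reach_const (hL : 2 ≤ L) (hh : 0 < h) (hhJ : h < J)
    (hJh : ∀ k : ℤ, J / (2 * h) - 1 / 2 ≠ k) (σ : Config L) :
    ∃ η ∈ ({allMinus L, allPlus L} : Set (Config L)), Reach J h (energy J h σ + 2 * J) σ η := by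
  let r : Config L → Config L → Prop := fun η σ => energy J h η < energy J h σ ∨
    energy J h η ≤ energy J h σ ∧ magnetization σ < magnetization η
  have : IsTrans (Config L) r := ⟨by
    rintro a b c (h1 | ⟨h1, h2⟩) (h3 | ⟨h3, h4⟩)
    · exact Or.inl (h1.trans h3)
    · exact Or.inl (h1.trans_le h3)
    · exact Or.inl (h1.trans_lt h3)
    · exact Or.inr ⟨h1.trans h3, h4.trans h2⟩⟩
  have : Std.Irrefl r := ⟨by
    rintro a (h1 | ⟨h1, h2⟩)
    · exact lt_irrefl _ h1
    · exact lt_irrefl _ h2⟩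
  have wf : WellFounded r := Finite.wellFounded_of_trans_of_irrefl r
  induction σ using wf.induction with
  | _ σ ih =>
    by_cases h1 : σ = allMinus L
    · exact ⟨σ, by simp [h1], .refl⟩
    by_cases h2 : σ = allPlus L
    · exact ⟨σ, by simp [h2], .refl⟩
    obtain ⟨η, h3, h4⟩ := improves_of_ne hL hh hhJ hJh h1 h2
    obtain ⟨ζ, h5, h6⟩ := ih η h4
    have hle : energy J h η ≤ energy J h σ := h4.elim le_of_lt And.left
    -- Improvements never raise the energy, so successive heights of $2J$ do not accumulate.
    exact ⟨ζ, h5, h3.trans (h6.mono (by linarith))⟩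

/-- Without a bound on the height every configuration is connected to the plus configuration. -/
theorem exists_forall_reach_allPlus (J h : ℝ) :
    ∃ V, ∀ σ : Config L, ∃ η ∈ ({allPlus L} : Set (Config L)), Reach J h (energy J h σ + V) σ η := by
  obtain ⟨M, hM⟩ := (Set.finite_range (energy (L := L) J h)).bddAbove
  obtain ⟨m, hm⟩ := (Set.finite_range (energy (L := L) J h)).bddBelow
  have hM' : ∀ σ, energy (L := L) J h σ ≤ M := fun σ => hM ⟨σ, rfl⟩
  have hm' : ∀ σ, m ≤ energy (L := L) J h σ := fun σ => hm ⟨σ, rfl⟩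
  refine ⟨M - m, fun σ => ⟨allPlus L, rfl, Reach.mono (c := M) (by linarith [hm' σ]) ?_⟩⟩
  classical
  generalize hn : (Finset.univ.filter fun x => σ x ≠ 1).card = n
  induction n generalizing σ with
  | zero =>
    have : σ = allPlus L := by
      funext x
      by_contra hx
      have : x ∈ Finset.univ.filter fun x => σ x ≠ 1 :=
        Finset.mem_filter.2 ⟨Finset.mem_univ x, hx⟩
      rw [Finset.card_eq_zero.1 hn] at this
      simp at this
    rw [this]
    exact .refl
  | succ n ih =>
    obtain ⟨x, hx⟩ := Finset.card_pos.1 (by rw [hn]; exact n.succ_pos)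
    have hx1 : σ x ≠ 1 := by simpa using hx
    refine Relation.ReflTransGen.head ⟨⟨x, rfl⟩, hM' _, hM' _⟩ (ih (flip σ x) ?_)
    have : (Finset.univ.filter fun y => flip σ x y ≠ 1)
        = (Finset.univ.filter fun y => σ y ≠ 1).erase x := by
      ext y
      by_cases hy : y = x
      · subst hy
        simp [flip_apply_self, eq_neg_one_of_ne_one hx1]
      · simp [flip_apply_ne σ hy, hy]
    rw [this, Finset.card_erase_of_mem hx, hn]
    rfl

end Wells

/-! ### Reversibility and Poincaré inequality of the Metropolis dynamics -/

section Metropolis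

variable {L : ℕ} [NeZero L] (J h : ℝ) (β : ℝ≥0)

/-- The Boltzmann weight. -/
noncomputable def weight (σ : Config L) : ℝ := Real.exp (-(β : ℝ) * energy J h σ)

/-- The Dirichlet form of the Metropolis dynamics (times two). -/
noncomputable def dirichlet (f : Config L → ℝ) : ℝ :=
  ∑ σ, ∑ η, weight J h β σ * transProb J h β σ η * (f σ - f η) ^ 2

lemma weight_pos (σ : Config L) : 0 < weight J h β σ := Real.exp_pos _

lemma weight_mul_transProb_of_ne {σ η : Config L} (hne : η ≠ σ) :
    weight J h β σ * transProb J h β σ η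
      = connectivity σ η * Real.exp (-(β : ℝ) * max (energy J h σ) (energy J h η)) := by
  rw [transProb, if_neg hne, jumpProb, weight, mul_left_comm, ← Real.exp_add]
  congr 2
  rw [← mul_add]
  congr 1
  rcases le_total (energy J h σ) (energy J h η) with h1 | h1
  · rw [max_eq_left (by linarith), max_eq_right h1]; ring
  · rw [max_eq_right (by linarith), max_eq_left h1]; ring

lemma connectivity_comm (σ η : Config L) : connectivity σ η = connectivity η σ := by
  have : (∃ x, flip σ x = η) ↔ ∃ x, flip η x = σ := by
    constructor <;> rintro ⟨x, rfl⟩ <;> exact ⟨x, flip_flip _ x⟩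
  simp only [connectivity, this]

lemma weight_mul_transProb_comm (σ η : Config L) :
    weight J h β σ * transProb J h β σ η = weight J h β η * transProb J h β η σ := by
  by_cases hne : η = σ
  · rw [hne]
  · rw [weight_mul_transProb_of_ne J h β hne, weight_mul_transProb_of_ne J h β (Ne.symm hne),
      connectivity_comm, max_comm]

lemma dirichlet_term_nonneg (f : Config L → ℝ) (σ η : Config L) :
    0 ≤ weight J h β σ * transProb J h β σ η * (f σ - f η) ^ 2 :=
  mul_nonneg (mul_nonneg (weight_pos J h β σ).le (transProb_nonneg J h β σ η)) (sq_nonneg _)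

lemma dirichlet_nonneg (f : Config L → ℝ) : 0 ≤ dirichlet J h β f :=
  Finset.sum_nonneg fun σ _ => Finset.sum_nonneg fun η _ => dirichlet_term_nonneg J h β f σ η

variable {J h β}

/-- By detailed balance the conductance of a flip is $e^{-\beta\max(H(\sigma),H(\eta))}/|\Lambda|$,
here at least $e^{-\beta c}/|\Lambda|$; a single term of the Dirichlet form gives the bound. -/
lemma FlipBelow.sq_le {c : ℝ} {σ η : Config L} (H : FlipBelow J h c σ η) (f : Config L → ℝ) :
    (f σ - f η) ^ 2 * Real.exp (-(β : ℝ) * c) ≤ Fintype.card (Site L) * dirichlet J h β f := by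
  obtain ⟨⟨x, rfl⟩, h1, h2⟩ := H
  have hc : connectivity σ (flip σ x) = 1 / (Fintype.card (Site L) : ℝ) := if_pos ⟨x, rfl⟩
  have hpos : (0 : ℝ) < Fintype.card (Site L) := by
    exact_mod_cast Fintype.card_pos_iff.2 ⟨x⟩
  have h3 : weight J h β σ * transProb J h β σ (flip σ x) * (f σ - f (flip σ x)) ^ 2
      ≤ dirichlet J h β f :=
    (Finset.single_le_sum (f := fun η => weight J h β σ * transProb J h β σ η * (f σ - f η) ^ 2)
      (fun η _ => dirichlet_term_nonneg J h β f σ η) (Finset.mem_univ (flip σ x))).trans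
    (Finset.single_le_sum (f := fun σ => ∑ η, weight J h β σ * transProb J h β σ η * (f σ - f η) ^ 2)
      (fun σ _ => Finset.sum_nonneg fun η _ => dirichlet_term_nonneg J h β f σ η)
      (Finset.mem_univ σ))
  rw [weight_mul_transProb_of_ne J h β (flip_ne σ x), hc] at h3
  have h4 : Real.exp (-(β : ℝ) * c)
      ≤ Real.exp (-(β : ℝ) * max (energy J h σ) (energy J h (flip σ x))) := by
    refine Real.exp_le_exp.2 ?_
    have := mul_le_mul_of_nonneg_left (max_le h1 h2) β.coe_nonneg
    linarith
  calc _ ≤ (f σ - f (flip σ x)) ^ 2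
        * Real.exp (-(β : ℝ) * max (energy J h σ) (energy J h (flip σ x))) :=
        mul_le_mul_of_nonneg_left h4 (sq_nonneg _)
    _ = Fintype.card (Site L) * (1 / (Fintype.card (Site L) : ℝ)
        * Real.exp (-(β : ℝ) * max (energy J h σ) (energy J h (flip σ x)))
        * (f σ - f (flip σ x)) ^ 2) := by field_simp
    _ ≤ _ := mul_le_mul_of_nonneg_left h3 hpos.le

/-- The constant depends on the path alone, not on `β` or `f`; this uniformity makes $e^{\beta V}$
the only exponential factor in the Poincaré constant. -/
lemma Reach.exists_sq_le {c : ℝ} {σ η : Config L} (H : Reach J h c σ η) :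
    ∃ K : ℝ, 0 ≤ K ∧ ∀ (β : ℝ≥0) (f : Config L → ℝ),
      (f σ - f η) ^ 2 * Real.exp (-(β : ℝ) * c) ≤ K * dirichlet J h β f := by
  induction H with
  | refl => exact ⟨0, le_rfl, fun β f => by simp⟩
  | @tail η ζ _ h1 ih =>
    obtain ⟨K, hK, ih⟩ := ih
    refine ⟨2 * K + 2 * Fintype.card (Site L), by positivity, fun β f => ?_⟩
    have h2 := h1.sq_le (β := β) f
    have h3 := ih β f
    have h4 : (f σ - f ζ) ^ 2 ≤ 2 * (f σ - f η) ^ 2 + 2 * (f η - f ζ) ^ 2 := by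
      nlinarith [sq_nonneg ((f σ - f η) - (f η - f ζ))]
    have := mul_le_mul_of_nonneg_right h4 (Real.exp_pos (-(β : ℝ) * c)).le
    linarith

/-- If from every configuration the set `B` can be reached at height at most `V`, the Metropolis
dynamics killed on `B` satisfies a Poincaré inequality with constant of order `exp (β V)`. -/
theorem exists_poincare {V : ℝ} {B : Set (Config L)}
    (hB : ∀ σ, ∃ η ∈ B, Reach J h (energy J h σ + V) σ η) :
    ∃ K : ℝ, 0 < K ∧ ∀ (β : ℝ≥0) (f : Config L → ℝ), (∀ σ ∈ B, f σ = 0) →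
      ∑ σ, weight J h β σ * f σ ^ 2 ≤ K * Real.exp (β * V) * dirichlet J h β f := by
  choose b hbB hb using hB
  choose K hK hKf using fun σ => (hb σ).exists_sq_le
  refine ⟨1 + ∑ σ, K σ, by linarith [Finset.sum_nonneg fun σ (_ : σ ∈ Finset.univ) => hK σ],
    fun β f hf => ?_⟩
  have h1 : ∀ σ, weight J h β σ * f σ ^ 2 ≤ K σ * (Real.exp (β * V) * dirichlet J h β f) := by
    intro σ
    have h2 := hKf σ β f
    rw [hf _ (hbB σ), sub_zero] at h2
    have e : weight J h β σ = Real.exp (-(β : ℝ) * (energy J h σ + V)) * Real.exp (β * V) := by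
      rw [weight, ← Real.exp_add]; congr 1; ring
    rw [e]
    have := mul_le_mul_of_nonneg_right h2 (Real.exp_pos (β * V)).le
    linarith
  have h3 := Finset.sum_le_sum fun σ (_ : σ ∈ Finset.univ) => h1 σ
  rw [← Finset.sum_mul] at h3
  have h4 := mul_nonneg (Real.exp_pos (β * V)).le (dirichlet_nonneg J h β f)
  rw [mul_assoc, add_mul, one_mul]
  linarith

/-- Uniform bound on the probability that `B` is not hit, under the assumption of
`exists_poincare`. -/
theorem exists_survival_le {V : ℝ} {B : Set (Config L)}
    (hB : ∀ σ, ∃ η ∈ B, Reach J h (energy J h σ + V) σ η) :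
    ∃ K A W : ℝ, 0 < K ∧ ∀ (β : ℝ≥0) (n : ℕ) (σ : Config L),
      survival (transProb J h β) B (2 * n) σ
        ≤ A * Real.exp (β * W) * Real.exp (-(n / (K * Real.exp (β * V)))) := by
  obtain ⟨K, hK, hpoinc⟩ := exists_poincare hB
  obtain ⟨M, hM⟩ := (Set.finite_range (energy (L := L) J h)).bddAbove
  obtain ⟨m, hm⟩ := (Set.finite_range (energy (L := L) J h)).bddBelow
  have hM' : ∀ σ, energy (L := L) J h σ ≤ M := fun σ => hM ⟨σ, rfl⟩
  have hm' : ∀ σ, m ≤ energy (L := L) J h σ := fun σ => hm ⟨σ, rfl⟩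
  refine ⟨2 * K, Fintype.card (Config L), M - m, by positivity, fun β n σ => ?_⟩
  have h1 := survival_le_exp (B := B) (weight_mul_transProb_comm J h β) (transProb_nonneg J h β)
    (sum_transProb J h β) (weight_pos J h β) (C := K * Real.exp (β * V)) (by positivity)
    (fun f hf => hpoinc β f hf) n σ
  refine h1.trans ?_
  rw [show 2 * (K * Real.exp (β * V)) = 2 * K * Real.exp (β * V) by ring]
  refine mul_le_mul_of_nonneg_right ?_ (Real.exp_pos _).le
  rw [div_le_iff₀ (weight_pos J h β σ), mul_assoc, weight, ← Real.exp_add]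
  have h2 : ∀ η ∈ (Finset.univ : Finset (Config L)), weight J h β η ≤ Real.exp (-(β : ℝ) * m) :=
    fun η _ => Real.exp_le_exp.2 (by linarith [mul_le_mul_of_nonneg_left (hm' η) β.coe_nonneg])
  have h3 := Finset.sum_le_card_nsmul _ _ _ h2
  rw [nsmul_eq_mul, Finset.card_univ] at h3
  refine h3.trans (mul_le_mul_of_nonneg_left (Real.exp_le_exp.2 ?_) (Nat.cast_nonneg _))
  linarith [mul_le_mul_of_nonneg_left (hM' σ) β.coe_nonneg]

/-- The probability that the chain leaves the minus configuration in one step. -/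
lemma one_sub_transProb_allMinus_le (hL : 2 ≤ L) (hJ : h ≤ 3 * J) :
    1 - transProb J h β (allMinus L) (allMinus L) ≤ Real.exp (-(β : ℝ) * (3 * J - h)) := by
  rw [transProb, if_pos rfl, sub_sub_cancel]
  -- All flips from $\underline{-1}$ cost the same $3J-h$, so the jump probabilities are those at `β
  -- = 0`, of sum at most one, times a common factor.
  have h0 := sum_jumpProb_le_one (L := L) J h 0 (allMinus L)
  have h1 : ∀ ζ, jumpProb J h β (allMinus L) ζ
      = jumpProb J h 0 (allMinus L) ζ * Real.exp (-(β : ℝ) * (3 * J - h)) := by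
    intro ζ
    by_cases hζ : ∃ x, flip (allMinus L) x = ζ
    · obtain ⟨x, rfl⟩ := hζ
      rw [jumpProb, jumpProb, energy_flip_allMinus hL, add_sub_cancel_left,
        max_eq_left (by linarith)]
      simp
    · simp [jumpProb, connectivity, hζ]
  rw [Finset.sum_congr rfl fun ζ _ => h1 ζ, ← Finset.sum_mul]
  exact mul_le_of_le_one_left (Real.exp_pos _).le h0

end Metropolis

/-! ### Identification with the law of the trajectories -/

section PathMeasure

variable {L : ℕ} [NeZero L] (J h : ℝ) (β : ℝ≥0) (σ : Config L)

instance : IsProbabilityMeasure (chainLaw J h β σ) := by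
  unfold chainLaw; infer_instance

lemma stepKernel_singleton (ζ η : Config L) :
    stepKernel J h β ζ {η} = ENNReal.ofReal (transProb J h β ζ η) := by
  have : stepKernel J h β ζ = (stepPMF J h β ζ).toMeasure := rfl
  rw [this, PMF.toMeasure_apply_singleton _ _ (measurableSet_singleton η)]
  rfl

lemma chainLaw_map_frestrictLe_zero :
    (chainLaw J h β σ).map (Preorder.frestrictLe (π := fun _ => Config L) 0)
      = Measure.dirac fun _ => σ := by
  rw [chainLaw, Kernel.trajMeasure, Measure.map_comp _ _ (by fun_prop),
    Kernel.traj_map_frestrictLe, Kernel.partialTraj_self, Measure.id_comp,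
    Measure.map_dirac' (by fun_prop)]
  rfl

lemma chainLaw_zero : ∀ᵐ X ∂chainLaw J h β σ, X 0 = σ := by
  have h1 : ∀ᵐ y ∂(chainLaw J h β σ).map (Preorder.frestrictLe (π := fun _ => Config L) 0),
      y ⟨0, Finset.mem_Iic.2 le_rfl⟩ = σ := by
    rw [chainLaw_map_frestrictLe_zero, ae_dirac_eq]
    rfl
  exact ae_of_ae_map (by fun_prop) h1

/-- The Markov property: the last step is independent of the past given the present. -/
lemma chainLaw_step (n : ℕ) (S : Set (Π _ : Finset.Iic n, Config L)) (ζ η : Config L)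
    (hS : ∀ y ∈ S, y ⟨n, Finset.mem_Iic.2 le_rfl⟩ = ζ) :
    chainLaw J h β σ {X | Preorder.frestrictLe (π := fun _ => Config L) n X ∈ S ∧ X (n + 1) = η}
      = chainLaw J h β σ {X | Preorder.frestrictLe (π := fun _ => Config L) n X ∈ S}
        * ENNReal.ofReal (transProb J h β ζ η) := by
  have hmS : MeasurableSet S := S.to_countable.measurableSet
  have key := Kernel.map_frestrictLe_trajMeasure_compProd_eq_map_trajMeasure
    (X := fun _ => Config L) (μ₀ := Measure.dirac σ)
    (κ := fun n => (stepKernel J h β).comap (fun x => x ⟨n, Finset.mem_Iic.2 le_rfl⟩)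
      (measurable_pi_apply _)) (a := n)
  have h1 := congrArg (fun μ => μ (S ×ˢ {η})) key
  rw [Measure.compProd_apply_prod hmS (measurableSet_singleton η),
    Measure.map_apply (by fun_prop) (hmS.prod (measurableSet_singleton η))] at h1
  have h2 : ∀ y ∈ S, (stepKernel J h β).comap (fun x : Π _ : Finset.Iic n, Config L =>
      x ⟨n, Finset.mem_Iic.2 le_rfl⟩) (measurable_pi_apply _) y {η}
      = ENNReal.ofReal (transProb J h β ζ η) := by
    intro y hy
    rw [Kernel.comap_apply, hS y hy, stepKernel_singleton]
  rw [setLIntegral_congr_fun hmS h2, setLIntegral_const, Measure.map_apply (by fun_prop) hmS] at h1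
  rw [mul_comm] at h1
  exact h1.symm

/-- The probability of avoiding `A` at the times `0, …, n` and being at `η` at time `n`. -/
noncomputable def avoidProb (A : Set (Config L)) (n : ℕ) (η : Config L) : ℝ :=
  (chainLaw J h β σ).real {X | (∀ k ≤ n, X k ∉ A) ∧ X n = η}

variable {A : Set (Config L)}

lemma measurableSet_avoid (n : ℕ) : MeasurableSet {X : ℕ → Config L | ∀ k ≤ n, X k ∉ A} := by
  have : {X : ℕ → Config L | ∀ k ≤ n, X k ∉ A} = ⋂ k, ⋂ (_ : k ≤ n), (fun X => X k) ⁻¹' Aᶜ := by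
    ext X; simp
  rw [this]
  exact MeasurableSet.iInter fun k => MeasurableSet.iInter fun _ =>
    measurable_pi_apply k (Aᶜ.to_countable.measurableSet)

lemma measurableSet_eq (n : ℕ) (ζ : Config L) : MeasurableSet {X : ℕ → Config L | X n = ζ} := by
  have : {X : ℕ → Config L | X n = ζ} = (fun X => X n) ⁻¹' {ζ} := by
    ext X; simp
  rw [this]
  exact measurable_pi_apply n (measurableSet_singleton ζ)

lemma avoidProb_succ (n : ℕ) {η : Config L} (hη : η ∉ A) :
    avoidProb J h β σ A (n + 1) η = ∑ ζ, avoidProb J h β σ A n ζ * transProb J h β ζ η := by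
  have h1 : {X : ℕ → Config L | (∀ k ≤ n + 1, X k ∉ A) ∧ X (n + 1) = η}
      = ⋃ ζ ∈ (Finset.univ : Finset (Config L)), {X | ((∀ k ≤ n, X k ∉ A) ∧ X n = ζ) ∧ X (n + 1) = η} := by
    ext X
    simp only [Finset.mem_univ, Set.iUnion_true, Set.mem_iUnion, Set.mem_ofPred_eq]
    constructor
    · rintro ⟨h1, h2⟩
      exact ⟨X n, ⟨fun k hk => h1 k (by lia), rfl⟩, h2⟩
    · rintro ⟨ζ, ⟨h1, -⟩, h2⟩
      refine ⟨fun k hk => ?_, h2⟩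
      rcases Nat.lt_or_ge n k with hk' | hk'
      · rw [show k = n + 1 by lia, h2]; exact hη
      · exact h1 k hk'
  rw [avoidProb, h1, measureReal_biUnion_finset]
  · refine Finset.sum_congr rfl fun ζ _ => ?_
    have h2 := chainLaw_step J h β σ n
      {y | (∀ k : Finset.Iic n, y k ∉ A) ∧ y ⟨n, Finset.mem_Iic.2 le_rfl⟩ = ζ} ζ η (fun y hy => hy.2)
    have e : ∀ X : ℕ → Config L, Preorder.frestrictLe (π := fun _ => Config L) n X
        ∈ {y : Π _ : Finset.Iic n, Config L |
          (∀ k : Finset.Iic n, y k ∉ A) ∧ y ⟨n, Finset.mem_Iic.2 le_rfl⟩ = ζ}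
        ↔ (∀ k ≤ n, X k ∉ A) ∧ X n = ζ := by
      intro X
      simp [Preorder.frestrictLe]
    simp only [e] at h2
    rw [measureReal_def, h2, ENNReal.toReal_mul, ENNReal.toReal_ofReal (transProb_nonneg J h β ζ η)]
    rfl
  · intro ζ _ ζ' _ hne
    refine Set.disjoint_left.2 fun X h2 h3 => hne ?_
    exact h2.1.2.symm.trans h3.1.2
  · exact fun ζ _ => (((measurableSet_avoid n).inter (measurableSet_eq n ζ)).inter
      (measurableSet_eq (n + 1) η))

lemma avoidProb_of_mem (n : ℕ) {η : Config L} (hη : η ∈ A) : avoidProb J h β σ A n η = 0 := by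
  have : {X : ℕ → Config L | (∀ k ≤ n, X k ∉ A) ∧ X n = η} = ∅ := by
    ext X
    simp only [Set.mem_ofPred_eq, Set.mem_empty_iff_false, iff_false]
    rintro ⟨h1, rfl⟩
    exact h1 n le_rfl hη
  rw [avoidProb, this, measureReal_empty]

/-- The trajectory law is described by its last step, `survival` by its first. Moving one step from
one factor to the other leaves the sum unchanged, which reconciles the two. -/
lemma sum_avoidProb_mul_survival (n k : ℕ) :
    ∑ η, avoidProb J h β σ A n η * survival (transProb J h β) A k η
      = ∑ η, avoidProb J h β σ A (n + k) η * survival (transProb J h β) A 0 η := by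
  induction k generalizing n with
  | zero => rfl
  | succ k ih =>
    rw [show n + (k + 1) = n + 1 + k by ring, ← ih (n + 1)]
    have e : ∀ ζ, avoidProb J h β σ A n ζ * survival (transProb J h β) A (k + 1) ζ
        = ∑ η, avoidProb J h β σ A n ζ * transProb J h β ζ η * survival (transProb J h β) A k η := by
      intro ζ
      by_cases hζ : ζ ∈ A
      · simp [avoidProb_of_mem J h β σ n hζ]
      · rw [survival_succ _ hζ, Finset.mul_sum]
        exact Finset.sum_congr rfl fun η _ => by ring
    simp only [e]
    rw [Finset.sum_comm]
    refine Finset.sum_congr rfl fun η _ => ?_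
    rw [← Finset.sum_mul]
    by_cases hη : η ∈ A
    · simp [survival_of_mem _ hη]
    · rw [avoidProb_succ J h β σ n hη]

lemma sum_avoidProb (n : ℕ) :
    ∑ η, avoidProb J h β σ A n η = (chainLaw J h β σ).real {X | ∀ k ≤ n, X k ∉ A} := by
  have h1 : {X : ℕ → Config L | ∀ k ≤ n, X k ∉ A}
      = ⋃ ζ ∈ (Finset.univ : Finset (Config L)), {X | (∀ k ≤ n, X k ∉ A) ∧ X n = ζ} := by
    ext X
    simp
  rw [h1, measureReal_biUnion_finset]
  · rfl
  · intro ζ _ ζ' _ hne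
    exact Set.disjoint_left.2 fun X h2 h3 => hne (h2.2.symm.trans h3.2)
  · exact fun ζ _ => (measurableSet_avoid n).inter (measurableSet_eq n ζ)

lemma chainLaw_avoid (n : ℕ) :
    (chainLaw J h β σ).real {X | ∀ k ≤ n, X k ∉ A} = survival (transProb J h β) A n σ := by
  have h1 := sum_avoidProb_mul_survival J h β σ (A := A) 0 n
  rw [zero_add] at h1
  have h2 : ∀ n η, avoidProb J h β σ A n η * survival (transProb J h β) A 0 η
      = avoidProb J h β σ A n η := by
    intro n η
    by_cases hη : η ∈ A
    · simp [avoidProb_of_mem J h β σ n hη]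
    · rw [survival_zero hη, mul_one]
  have h3 : ∀ η, η ≠ σ → avoidProb J h β σ A 0 η = 0 := by
    intro η hη
    rw [avoidProb, measureReal_eq_zero_iff]
    refine measure_mono_null ?_ (ae_iff.1 (chainLaw_zero J h β σ))
    rintro X ⟨-, hX⟩ h0
    exact hη (hX.symm.trans h0)
  simp only [h2] at h1
  rw [sum_avoidProb, Finset.sum_eq_single σ (fun η _ hη => by rw [h3 η hη, zero_mul]) (by simp)] at h1
  rw [← h1]
  by_cases hσ : σ ∈ A
  · simp [survival_of_mem _ hσ]
  have h4 : avoidProb J h β σ A 0 σ = 1 := by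
    have : ∀ᵐ X ∂chainLaw J h β σ, (∀ k ≤ 0, X k ∉ A) ∧ X 0 = σ := by
      filter_upwards [chainLaw_zero J h β σ] with X hX
      refine ⟨fun k hk => ?_, hX⟩
      rw [Nat.le_zero.1 hk, hX]
      exact hσ
    have h5 : chainLaw J h β σ {X | (∀ k ≤ 0, X k ∉ A) ∧ X 0 = σ} = 1 :=
      (prob_compl_eq_zero_iff ((measurableSet_avoid 0).inter (measurableSet_eq 0 σ))).1 this
    rw [avoidProb, measureReal_def, h5, ENNReal.toReal_one]
  rw [h4, one_mul]

omit [NeZero L] in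
lemma lt_hitTime_iff (n : ℕ) (X : ℕ → Config L) :
    (n : ℕ∞) < hitTime A X ↔ ∀ k, 1 ≤ k → k ≤ n → X k ∉ A := by
  have h1 : hitTime A X ≤ n ↔ ∃ j ∈ Set.Icc 1 n, X j ∈ A := hittingAfter_le_iff
  rw [← not_le, h1]
  simp only [Set.mem_Icc, not_exists, not_and, and_imp]

lemma measurableSet_lt_hitTime (n : ℕ) : MeasurableSet {X : ℕ → Config L | (n : ℕ∞) < hitTime A X} := by
  simp only [lt_hitTime_iff]
  have : {X : ℕ → Config L | ∀ k, 1 ≤ k → k ≤ n → X k ∉ A}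
      = ⋂ k, ⋂ (_ : 1 ≤ k), ⋂ (_ : k ≤ n), (fun X => X k) ⁻¹' Aᶜ := by
    ext X; simp
  rw [this]
  exact MeasurableSet.iInter fun k => MeasurableSet.iInter fun _ => MeasurableSet.iInter fun _ =>
    measurable_pi_apply k (Aᶜ.to_countable.measurableSet)

/-- The tail of the hitting time. -/
theorem chainLaw_lt_hitTime (hσ : σ ∉ A) (n : ℕ) :
    (chainLaw J h β σ).real {X | (n : ℕ∞) < hitTime A X} = survival (transProb J h β) A n σ := by
  rw [← chainLaw_avoid]
  refine measureReal_congr ?_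
  filter_upwards [chainLaw_zero J h β σ] with X hX
  refine propext ?_
  change (n : ℕ∞) < hitTime A X ↔ ∀ k ≤ n, X k ∉ A
  rw [lt_hitTime_iff]
  refine ⟨fun H k hk => ?_, fun H k _ hk => H k hk⟩
  rcases Nat.eq_zero_or_pos k with rfl | hk0
  · rw [hX]; exact hσ
  · exact H k hk0 hk

theorem chainLaw_hitTime_le (hσ : σ ∉ A) (n : ℕ) :
    (chainLaw J h β σ).real {X | hitTime A X ≤ n} = 1 - survival (transProb J h β) A n σ := by
  rw [← chainLaw_lt_hitTime J h β σ hσ n, ← probReal_compl_eq_one_sub (measurableSet_lt_hitTime n)]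
  congr 1
  ext X
  simp

/-- The mean of the hitting time is the sum of its tail. -/
theorem lintegral_hitTime (hσ : σ ∉ A) :
    ∫⁻ X, (hitTime A X : ℝ≥0∞) ∂chainLaw J h β σ
      = ∑' n, ENNReal.ofReal (survival (transProb J h β) A n σ) := by
  have h1 : ∀ N : ℕ∞, (N : ℝ≥0∞) = ∑' n : ℕ, if (n : ℕ∞) < N then (1 : ℝ≥0∞) else 0 := by
    intro N
    induction N using ENat.recTopCoe with
    | top => simp
    | coe N =>
      rw [tsum_eq_sum (s := Finset.range N) (fun n hn => by simpa using hn)]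
      rw [Finset.sum_congr rfl (g := fun _ => (1 : ℝ≥0∞)) (fun n hn => by
        simpa using hn)]
      simp
  have h2 : ∀ (n : ℕ) (X : ℕ → Config L), (if (n : ℕ∞) < hitTime A X then (1 : ℝ≥0∞) else 0)
      = Set.indicator {X | (n : ℕ∞) < hitTime A X} 1 X := fun n X => by
    simp [Set.indicator_apply]
  simp only [h1, h2]
  rw [lintegral_tsum fun n => (measurable_one.indicator (measurableSet_lt_hitTime n)).aemeasurable]
  refine tsum_congr fun n => ?_
  rw [lintegral_indicator_one (measurableSet_lt_hitTime n), ← chainLaw_lt_hitTime J h β σ hσ n,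
    ofReal_measureReal]

end PathMeasure

/-! ### Quantitative loss of memory -/

section Quantitative

variable {X : Type*} [Fintype X] {P : X → X → ℝ} (hP : ∀ x y, 0 ≤ P x y)
  (hP1 : ∀ x, ∑ y, P x y = 1) {m s : X} (hms : m ≠ s) {R : ℕ} {ε δ : ℝ}
  (hε : ∀ x, survival P {m, s} R x ≤ ε) (hδ : ε + (1 - survival P {s} (R + R) m) ≤ δ)
include hP hP1 hms hε hδ

/-- Approximate loss of memory. -/
lemma abs_survival_add_sub_le (n k : ℕ) :
    |survival P {s} (n + k) m - survival P {s} n m * survival P {s} k m| ≤ 2 * δ := by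
  have h0 := fun n => survival_nonneg (B := {s}) hP n m
  have h1 := fun n => survival_le_one (B := {s}) hP hP1 n m
  have hanti := survival_antitone (B := {s}) hP hP1 m
  have hε0 : 0 ≤ ε := (survival_nonneg hP R m).trans (hε m)
  have hε1 : ε ≤ δ := by linarith [h1 (R + R)]
  have hc := fun n => (survival_sub_le hP hP1 hms hε n).trans hδ
  rw [abs_le]
  constructor
  · have h2 := mul_le_survival_add hP hP1 hms hε n k
    have h3 : survival P {s} n m - 2 * δ ≤ survival P {s} (n + R) m - ε * survival P {s} n m := by
      have := mul_le_of_le_one_right hε0 (h1 n)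
      linarith [hc n]
    have h4 := mul_le_mul_of_nonneg_left h3 (h0 k)
    nlinarith [h0 k, h1 k]
  -- For `k ≥ R`, `R` of the `k` steps serve for returning to `{m, s}`, which changes the tail by at
  -- most `δ`. For `k < R` the tail at `k` is at least `1 - δ`, and monotonicity suffices.
  · rcases le_or_gt R k with hk | hk
    · obtain ⟨k, rfl⟩ := Nat.exists_eq_add_of_le hk
      have h2 := survival_add_le_mul hP hP1 hms hε n k
      have h3 := hc k
      rw [add_comm k R] at h3
      have h4 : ε + survival P {s} k m ≤ 2 * δ + survival P {s} (R + k) m := by linarith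
      have h5 := mul_le_mul_of_nonneg_left h4 (h0 n)
      nlinarith [h0 n, h1 n]
    · have h2 : survival P {s} (R + R) m ≤ survival P {s} k m := hanti (by lia)
      have h3 : survival P {s} (n + k) m ≤ survival P {s} n m := hanti (by lia)
      nlinarith [h0 n, h1 n]

lemma survival_sub_succ_le (hR : 1 ≤ R) (n : ℕ) :
    survival P {s} n m - survival P {s} (n + 1) m ≤ δ := by
  have h1 : survival P {s} (n + R) m ≤ survival P {s} (n + 1) m :=
    survival_antitone (B := {s}) hP hP1 m (by lia)
  linarith [survival_sub_le hP hP1 hms hε n]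

/-- Since $s(2R)\ge 0.9>e^{-1}\ge s(T)$, the time $T$ exceeds $R$, so $s(n+2T)\le
s(n)(\varepsilon+s(T))$ with $0.1+e^{-1}<\frac12$. -/
lemma survival_add_le_half {T : ℕ} (hT : survival P {s} T m ≤ Real.exp (-1)) (hδ' : δ ≤ 1 / 10)
    (n : ℕ) : survival P {s} (n + (T + T)) m ≤ survival P {s} n m * (1 / 2) := by
  have hanti := survival_antitone (B := {s}) hP hP1 m
  have he := Real.exp_neg_one_lt_d9
  have hε0 : 0 ≤ ε := (survival_nonneg hP R m).trans (hε m)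
  have h1 := survival_le_one (B := {s}) hP hP1 (R + R) m
  have hRT : R ≤ T := by
    by_contra! hlt
    have h2 : survival P {s} (R + R) m ≤ survival P {s} T m := hanti (by lia)
    norm_num at he hδ'
    linarith
  have h3 : survival P {s} (n + (T + T)) m ≤ survival P {s} (n + (R + T)) m := hanti (by lia)
  refine h3.trans ((survival_add_le_mul hP hP1 hms hε n T).trans ?_)
  refine mul_le_mul_of_nonneg_left ?_ (survival_nonneg hP n m)
  norm_num at he hδ' ⊢
  linarith

end Quantitative

/-- The prefactor $e^{\beta W}$ in `exists_survival_le` is only exponential in $\beta$, so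
$\exp(-e^{\kappa\beta}/K)$ overwhelms it whatever $W$ is. -/
lemma tendsto_mul_sub_exp_atBot (W : ℝ) {κ K : ℝ} (hκ : 0 < κ) (hK : 0 < K) :
    Tendsto (fun x : ℝ => x * W - Real.exp (κ * x) / K) atTop atBot := by
  have h1 : Tendsto (fun x : ℝ => W - κ ^ 2 / (2 * K) * x) atTop atBot := by
    have h2 : Tendsto (fun x : ℝ => κ ^ 2 / (2 * K) * x) atTop atTop :=
      tendsto_id.const_mul_atTop (by positivity)
    simpa [sub_eq_add_neg] using tendsto_atBot_add_const_left _ W (tendsto_neg_atTop_atBot.comp h2)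
  refine tendsto_atBot_mono' _ ?_ (tendsto_id.atTop_mul_atBot₀ h1)
  filter_upwards [eventually_ge_atTop 0] with x hx
  have h3 := Real.quadratic_le_exp_of_nonneg (mul_nonneg hκ.le hx)
  have h4 : (κ * x) ^ 2 / 2 / K ≤ Real.exp (κ * x) / K :=
    div_le_div_of_nonneg_right (by nlinarith [mul_nonneg hκ.le hx]) hK.le
  have e : (κ * x) ^ 2 / 2 / K = x * (κ ^ 2 / (2 * K) * x) := by field_simp
  simp only [id]
  linarith

/-! ### Choice of the recurrence time and conclusion -/

section Final

variable {L : ℕ} [NeZero L] {J h : ℝ}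

omit [NeZero L] in
lemma allMinus_ne_allPlus : allMinus L ≠ allPlus L := fun e =>
  absurd (congrFun e (Sum.inl (0, 0))) (by simp [allMinus, allPlus])

/-- The two constant configurations are hit within a time that is negligible with respect to the
time needed to leave the minus configuration. -/
lemma exists_recurrence (hL : 2 ≤ L) (hh : 0 < h) (hhJ : h < J)
    (hJh : ∀ k : ℤ, J / (2 * h) - 1 / 2 ≠ k) :
    ∃ (R : ℝ≥0 → ℕ) (ε δ : ℝ≥0 → ℝ), Tendsto δ atTop (𝓝 0) ∧ ∀ β, 1 ≤ R β ∧
      (∀ σ, survival (transProb J h β) {allMinus L, allPlus L} (R β) σ ≤ ε β) ∧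
      ε β + (1 - survival (transProb J h β) {allPlus L} (R β + R β) (allMinus L)) ≤ δ β := by
  have hne : allMinus L ∉ ({allPlus L} : Set (Config L)) := allMinus_ne_allPlus
  obtain ⟨K, A, W, hK, hsurv⟩ := exists_survival_le (exists_reach_const hL hh hhJ hJh)
  -- Here $2J+\kappa$ is the midpoint of $2J$ and $3J-h$: time $e^{\beta(2J+\kappa)}$ exceeds the
  -- relaxation scale by $e^{\kappa\beta}$ and falls short of the exit scale by the same factor.
  obtain ⟨κ, hκ, hκ2⟩ : ∃ κ : ℝ, 0 < κ ∧ J - h = 2 * κ := ⟨(J - h) / 2, by linarith, by ring⟩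
  let N : ℝ≥0 → ℕ := fun β : ℝ≥0 => ⌈Real.exp (β * (2 * J + κ))⌉₊
  have hN1 : ∀ β : ℝ≥0, Real.exp (β * (2 * J + κ)) ≤ N β := fun β => Nat.le_ceil _
  have hN2 : ∀ β : ℝ≥0, (N β : ℝ) ≤ 2 * Real.exp (β * (2 * J + κ)) := by
    intro β
    have h1 := Nat.ceil_lt_add_one (Real.exp_pos (β * (2 * J + κ))).le
    have h2 : 1 ≤ Real.exp (β * (2 * J + κ)) :=
      Real.one_le_exp (mul_nonneg β.coe_nonneg (by linarith))
    linarith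
  refine ⟨fun β => 2 * N β, fun β : ℝ≥0 => |A| * Real.exp (β * W - Real.exp (κ * β) / K),
    fun β : ℝ≥0 => |A| * Real.exp (β * W - Real.exp (κ * β) / K) + 8 * Real.exp (-(κ * β)), ?_,
    fun β => ⟨?_, fun σ => ?_, ?_⟩⟩
  · have hβ : Tendsto (fun β : ℝ≥0 => (β : ℝ)) atTop atTop := NNReal.tendsto_coe_atTop.2 tendsto_id
    have h1 := (Real.tendsto_exp_atBot.comp ((tendsto_mul_sub_exp_atBot W hκ hK).comp hβ)).const_mul |A|
    have h2 := (Real.tendsto_exp_atBot.comp (tendsto_neg_atTop_atBot.comp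
      (hβ.const_mul_atTop hκ))).const_mul 8
    simpa using h1.add h2
  · have : 0 < N β := Nat.ceil_pos.2 (Real.exp_pos _)
    lia
  · refine (hsurv β (N β) σ).trans ?_
    have h1 : Real.exp (κ * β) / K ≤ N β / (K * Real.exp (β * (2 * J))) := by
      rw [div_le_div_iff₀ hK (by positivity)]
      have h2 : Real.exp (κ * β) * Real.exp (β * (2 * J)) ≤ N β := by
        rw [← Real.exp_add]
        refine le_trans (le_of_eq ?_) (hN1 β)
        congr 1; ring
      have := mul_le_mul_of_nonneg_right h2 hK.le
      linarith
    rw [mul_assoc, ← Real.exp_add]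
    refine (mul_le_mul_of_nonneg_right (le_abs_self A) (Real.exp_pos _).le).trans ?_
    refine mul_le_mul_of_nonneg_left (Real.exp_le_exp.2 ?_) (abs_nonneg A)
    linarith
  · have h1 := one_sub_survival_le (transProb_nonneg J h β) (sum_transProb J h β) hne
      (one_sub_transProb_allMinus_le (β := β) hL (by linarith)) (2 * N β + 2 * N β)
    have h2 : ((2 * N β + 2 * N β : ℕ) : ℝ) * Real.exp (-(β : ℝ) * (3 * J - h))
        ≤ 8 * Real.exp (-(κ * β)) := by
      have h3 : Real.exp (-(κ * β))
          = Real.exp (β * (2 * J + κ)) * Real.exp (-(β : ℝ) * (3 * J - h)) := by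
        rw [← Real.exp_add]
        congr 1
        linear_combination (β : ℝ) * hκ2
      rw [h3]
      push_cast
      have := mul_le_mul_of_nonneg_right (hN2 β) (Real.exp_pos (-(β : ℝ) * (3 * J - h))).le
      linarith
    linarith

/-- For every temperature the plus configuration is eventually hit. -/
lemma exists_survival_allPlus_le (J h : ℝ) (β : ℝ≥0) :
    ∃ n, 1 ≤ n ∧ survival (transProb J h β) {allPlus L} n (allMinus L) ≤ Real.exp (-1) := by
  obtain ⟨V, hV⟩ := exists_forall_reach_allPlus (L := L) J h
  obtain ⟨K, A, W, hK, hsurv⟩ := exists_survival_le hV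
  have hpos : 0 < K * Real.exp (β * V) := by positivity
  have h1 : Tendsto (fun n : ℕ => A * Real.exp (β * W)
      * Real.exp (-((n : ℝ) / (K * Real.exp (β * V))))) atTop (𝓝 0) := by
    have h2 : Tendsto (fun n : ℕ => (n : ℝ) / (K * Real.exp (β * V))) atTop atTop :=
      tendsto_natCast_atTop_atTop.atTop_div_const hpos
    simpa using (Real.tendsto_exp_atBot.comp (tendsto_neg_atTop_atBot.comp h2)).const_mul
      (A * Real.exp (β * W))
  obtain ⟨n, hn1, hn2⟩ := ((h1.eventually (gt_mem_nhds (Real.exp_pos (-1)))).and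
    (eventually_ge_atTop 1)).exists
  exact ⟨2 * n, by lia, (hsurv β n _).trans hn1.le⟩

lemma quantileTime_eq (J h : ℝ) (β : ℝ≥0) :
    quantileTime L J h β = sInf {n : ℕ | 1 ≤ n ∧
      survival (transProb J h β) {allPlus L} n (allMinus L) ≤ Real.exp (-1)} := by
  have hne : allMinus L ∉ ({allPlus L} : Set (Config L)) := allMinus_ne_allPlus
  rw [quantileTime]
  congr 1
  ext n
  simp only [Set.mem_ofPred_eq, chainLaw_hitTime_le J h β _ hne, sub_le_sub_iff_left]

lemma ofReal_lt_coe_iff {x : ℝ} (hx : 0 ≤ x) (N : ℕ∞) :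
    ENNReal.ofReal x < (N : ℝ≥0∞) ↔ (⌊x⌋₊ : ℕ∞) < N := by
  induction N using ENat.recTopCoe with
  | top => simp
  | coe n =>
    rw [ENat.toENNReal_coe, Nat.cast_lt, Nat.floor_lt hx, ← ENNReal.ofReal_natCast,
      ENNReal.ofReal_lt_ofReal_iff', and_iff_left_of_imp fun h => hx.trans_lt h]

end Final

end HexIsing

open HexIsing

theorem theorem4 (L : ℕ) [NeZero L] (J h : ℝ) (hh0 : 0 < h) (hh1 : h < 1) (hJ : 2 * h ≤ J)
    (hJh : ∀ k : ℤ, J / (2 * h) - 1 / 2 ≠ k)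
    (hL : (4 * J / h) ^ 2 ≤ (Fintype.card (HexIsing.Site L) : ℝ)) :
    (∀ t : ℝ, 0 ≤ t →
      Tendsto (fun β : ℝ≥0 => (HexIsing.chainLaw J h β (HexIsing.allMinus L)).real
          {X | ENNReal.ofReal (t * HexIsing.quantileTime L J h β)
            < (HexIsing.hitTime {HexIsing.allPlus L} X : ℝ≥0∞)})
        atTop (𝓝 (Real.exp (-t)))) ∧
    Tendsto (fun β : ℝ≥0 => HexIsing.meanHitTime L J h β / (HexIsing.quantileTime L J h β : ℝ≥0∞))
      atTop (𝓝 1) := by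
  -- For $L=1$ there are two sites, but $(4J/h)^2\ge64$. From $L=2$ on, each site has three distinct
  -- neighbours.
  have hL2 : 2 ≤ L := by
    by_contra! hlt
    have hL1 : L = 1 := by have := NeZero.ne L; lia
    have h1 : (Fintype.card (Site L) : ℝ) = 2 := by
      subst hL1
      simp [Fintype.card_sum]
    rw [h1] at hL
    have h2 : 8 ≤ 4 * J / h := by rw [le_div_iff₀ hh0]; linarith
    nlinarith
  have hhJ : h < J := by linarith
  have hne : allMinus L ∉ ({allPlus L} : Set (Config L)) := allMinus_ne_allPlus
  obtain ⟨R, ε, δ, hδ, hR⟩ := exists_recurrence hL2 hh0 hhJ hJh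
  set s : ℝ≥0 → ℕ → ℝ := fun β n => survival (transProb J h β) {allPlus L} n (allMinus L) with hs
  set T : ℝ≥0 → ℕ := fun β => quantileTime L J h β with hT
  have hTspec : ∀ β, 1 ≤ T β ∧ s β (T β) ≤ Real.exp (-1) := by
    intro β
    rw [hT]
    simp only [quantileTime_eq]
    exact Nat.sInf_mem (exists_survival_allPlus_le J h β)
  have hTpred : ∀ β, Real.exp (-1) ≤ s β (T β - 1) := by
    intro β
    rcases (hTspec β).1.eq_or_lt with h1 | h1
    · rw [← h1, hs]
      simp only [Nat.sub_self]
      rw [survival_zero hne]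
      exact Real.exp_le_one_iff.2 (by norm_num)
    · by_contra! hlt
      have h2 : T β - 1 < sInf {n : ℕ | 1 ≤ n ∧
          survival (transProb J h β) {allPlus L} n (allMinus L) ≤ Real.exp (-1)} := by
        rw [← quantileTime_eq]; change T β - 1 < T β; lia
      exact Nat.notMem_of_lt_sInf h2 ⟨by lia, hlt.le⟩
  have hnn := fun β => transProb_nonneg (L := L) J h β
  have hsum := fun β => sum_transProb (L := L) J h β
  have hs0 : ∀ β, s β 0 = 1 := fun β => survival_zero hne
  have hanti : ∀ β, Antitone (s β) := fun β => survival_antitone (hnn β) (hsum β) _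
  have hmul : ∀ β n k, |s β (n + k) - s β n * s β k| ≤ 2 * δ β := fun β =>
    abs_survival_add_sub_le (hnn β) (hsum β) allMinus_ne_allPlus (hR β).2.1 (hR β).2.2
  have hδ0 : ∀ β, 0 ≤ δ β := fun β => by have := (abs_nonneg _).trans (hmul β 0 0); linarith
  have hjump : ∀ β n, s β n - s β (n + 1) ≤ δ β := fun β =>
    survival_sub_succ_le (hnn β) (hsum β) allMinus_ne_allPlus (hR β).2.1 (hR β).2.2 (hR β).1
  -- As $T$ is the first time the tail is at most $e^{-1}$, it was at least $e^{-1}$ one step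
  -- earlier, and one step changes it by at most `δ β`.
  have hsT : Tendsto (fun β => s β (T β)) atTop (𝓝 (Real.exp (-1))) := by
    refine tendsto_of_tendsto_of_tendsto_of_le_of_le
      (by simpa using (tendsto_const_nhds (x := Real.exp (-1))).sub hδ)
      tendsto_const_nhds (fun β => ?_) fun β => (hTspec β).2
    have h1 := hjump β (T β - 1)
    rw [Nat.sub_add_cancel (hTspec β).1] at h1
    have h2 := hTpred β
    simp only
    linarith
  have hexp : ∀ t : ℝ, 0 ≤ t → Tendsto (fun β => s β ⌊t * T β⌋₊) atTop (𝓝 (Real.exp (-t))) :=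
    tendsto_floor_exp (δ := fun β => 2 * δ β) (by simpa using hδ.const_mul 2) hs0 hanti
      (fun β n => survival_nonneg (hnn β) n _) (Eventually.of_forall hmul)
      (Eventually.of_forall fun β n => (hjump β n).trans (by linarith [hδ0 β])) hsT
  refine ⟨fun t ht => ?_, ?_⟩
  · refine (hexp t ht).congr fun β => ?_
    change survival (transProb J h β) {allPlus L} ⌊t * T β⌋₊ (allMinus L) = _
    rw [← chainLaw_lt_hitTime J h β (allMinus L) hne]
    simp only [ofReal_lt_coe_iff (mul_nonneg ht (Nat.cast_nonneg (quantileTime L J h β)))]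
    rfl
  · have h1 := tendsto_tsum_div (T := T) hs0 hanti (Eventually.of_forall fun β => (hTspec β).1) (by
      filter_upwards [hδ.eventually (Iic_mem_nhds (by norm_num : (0 : ℝ) < 1 / 10))] with β hβ
      exact survival_add_le_half (hnn β) (hsum β) allMinus_ne_allPlus (hR β).2.1 (hR β).2.2
        (hTspec β).2 hβ) hexp
    refine h1.congr fun β => ?_
    rw [meanHitTime, lintegral_hitTime J h β _ hne]
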